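/- Let $\Omega\subset\mathbb{R}^N$ be an open set and let $p\in(1,\infty)$. Let $W^{1,p}(\Omega)$ be the space of all $u\in L^p(\Omega)$ (real-valued, Lebesgue measure) whose first-order distributional partial derivatives $\partial_1u,\dots,\partial_Nu$ belong to $L^p(\Omega)$, with the norm given by $$\|u\|_{W^{1,p}(\Omega)}^p=\|u\|_{L^p(\Omega)}^p+\sum_{i=1}^N\|\partial_iu\|_{L^p(\Omega)}^p ,$$ and let $\tilde W^{1,p}(\Omega)$ be the closure in $W^{1,p}(\Omega)$ of the set of those elements of $W^{1,p}(\Omega)$ that are restrictions $f|_\Omega$ of continuous functions $f:\overline\Omega\to\mathbb{R}$ with compact support. For an arbitrary set $A\subset\overline\Omega$ define the relative $p$-capacity $$\mathrm{Cap}_{p,\Omega}(A)=\inf\Big\{\|u\|^p_{W^{1,p}(\Omega)}: u\in\tilde W^{1,p}(\Omega),\ \text{there is } O\supset A \text{ open in }\overline\Omega\text{ with } u\ge 1\text{ a.e. on }O\cap\Omega\Big\}\in[0,\infty],$$ where $\inf\emptyset=\infty$. Then $\mathrm{Cap}_{p,\Omega}$ is a normed Choquet capacity on the topological space $\overline\Omega$,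 that is: (C0) $\mathrm{Cap}_{p,\Omega}(\emptyset)=0$; (C1) $A\subset B\subset\overline\Omega$ implies $\mathrm{Cap}_{p,\Omega}(A)\le\mathrm{Cap}_{p,\Omega}(B)$; (C2) for every increasing sequence $(A_n)_n$ of arbitrary subsets of $\overline\Omega$, $\lim_n\mathrm{Cap}_{p,\Omega}(A_n)=\mathrm{Cap}_{p,\Omega}\big(\bigcup_nA_n\big)$; (C3) for every decreasing sequence $(K_n)_n$ of compact subsets of $\overline\Omega$, $\lim_n\mathrm{Cap}_{p,\Omega}(K_n)=\mathrm{Cap}_{p,\Omega}\big(\bigcap_nK_n\big)$. Moreover, for every $A\subset\overline\Omega$, $$\mathrm{Cap}_{p,\Omega}(A)=\inf\{\mathrm{Cap}_{p,\Omega}(O): O\text{ is open in }\overline\Omega\text{ and }A\subset O\}.$$ -/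

import Mathlib

open MeasureTheory Filter Topology TopologicalSpace

namespace RelCap

/-- The space `ℝ^N` with its Euclidean norm and Lebesgue measure. -/
abbrev RN (N : ℕ) : Type := EuclideanSpace ℝ (Fin N)

/-- `L^p(Ω)`: classes of `p`-integrable functions for Lebesgue measure on `Ω`. -/
abbrev LpOn {N : ℕ} (p : ℝ) (Ω : Opens (RN N)) : Type :=
  Lp ℝ (ENNReal.ofReal p) (volume.restrict (Ω : Set (RN N)))

/-- `g` is the `i`-th partial derivative of `u` in the sense of distributions on `Ω`:
`∫_Ω u ∂_i φ = - ∫_Ω g φ` for every test function `φ ∈ 𝒟(Ω)`. -/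
def HasWeakPartial {N : ℕ} {p : ℝ} {Ω : Opens (RN N)} (i : Fin N) (u g : LpOn p Ω) : Prop :=
  ∀ φ : TestFunction Ω ℝ ⊤,
    ∫ x in (Ω : Set (RN N)), u x * fderiv ℝ φ x (EuclideanSpace.single i 1)
      = - ∫ x in (Ω : Set (RN N)), g x * φ x

/-- The Sobolev space `W^{1,p}(Ω)`, as a set of elements of `L^p(Ω)`. -/
def W1p {N : ℕ} (p : ℝ) (Ω : Opens (RN N)) : Set (LpOn p Ω) :=
  {u | ∀ i : Fin N, ∃ g : LpOn p Ω, HasWeakPartial i u g}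

open Classical in
/-- The `i`-th weak partial derivative of `u` in `L^p(Ω)` (with value `0` if there is none).
For `1 ≤ p` it is unique, see `HasWeakPartial.unique`. -/
noncomputable def weakPartial {N : ℕ} {p : ℝ} {Ω : Opens (RN N)} (i : Fin N) (u : LpOn p Ω) :
    LpOn p Ω :=
  if h : ∃ g : LpOn p Ω, HasWeakPartial i u g then h.choose else 0

/-- `‖u‖^p_{W^{1,p}(Ω)} = ‖u‖_p^p + ∑_i ‖∂_i u‖_p^p`. -/
noncomputable def sobolevNormPow {N : ℕ} {p : ℝ} {Ω : Opens (RN N)} (u : LpOn p Ω) : ℝ :=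
  ‖u‖ ^ p + ∑ i : Fin N, ‖weakPartial i u‖ ^ p

/-- The norm of `W^{1,p}(Ω)`. -/
noncomputable def sobolevNorm {N : ℕ} {p : ℝ} {Ω : Opens (RN N)} (u : LpOn p Ω) : ℝ :=
  sobolevNormPow u ^ (1 / p)

/-- `W^{1,p}(Ω) ∩ C_c(closure Ω)`: the elements of `W^{1,p}(Ω)` that are the restriction to `Ω`
of a continuous function with compact support on the closure of `Ω`. -/
def W1pCc {N : ℕ} (p : ℝ) (Ω : Opens (RN N)) : Set (LpOn p Ω) :=
  {u | u ∈ W1p p Ω ∧ ∃ f : CompactlySupportedContinuousMap (closure (Ω : Set (RN N))) ℝ,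
    ∀ᵐ x ∂(volume.restrict (Ω : Set (RN N))),
      ∀ hx : x ∈ closure (Ω : Set (RN N)), u x = f ⟨x, hx⟩}

/-- The closure of `W^{1,p}(Ω) ∩ C_c(closure Ω)` in `W^{1,p}(Ω)`. -/
def W1pTilde {N : ℕ} (p : ℝ) (Ω : Opens (RN N)) : Set (LpOn p Ω) :=
  {u | u ∈ W1p p Ω ∧ ∀ ε : ℝ, 0 < ε → ∃ v ∈ W1pCc p Ω, sobolevNorm (u - v) < ε}

/-- The admissible functions for `A ⊆ closure Ω`: those `u` in `W1pTilde p Ω` with `u ≥ 1` a.e. on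
`O ∩ Ω` for some relatively open `O ⊆ closure Ω` containing `A`. -/
def admissible {N : ℕ} (p : ℝ) (Ω : Opens (RN N)) (A : Set (closure (Ω : Set (RN N)))) :
    Set (LpOn p Ω) :=
  {u | u ∈ W1pTilde p Ω ∧ ∃ O : Set (closure (Ω : Set (RN N))), IsOpen O ∧ A ⊆ O ∧
    ∀ᵐ x ∂(volume.restrict (Ω : Set (RN N))), x ∈ Subtype.val '' O → 1 ≤ u x}

/-- The relative `p`-capacity of a subset of the closure of `Ω`; it is `⊤` if there is no admissible
function. -/
noncomputable def relCap {N : ℕ} (p : ℝ) (Ω : Opens (RN N))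
    (A : Set (closure (Ω : Set (RN N)))) : EReal :=
  sInf ((fun u : LpOn p Ω => ((sobolevNormPow u : ℝ) : EReal)) '' admissible p Ω A)

/-- A Choquet capacity on a topological space. -/
structure IsChoquetCapacity {T : Type*} [TopologicalSpace T] (C : Set T → EReal) : Prop where
  mono : ∀ A B : Set T, A ⊆ B → C A ≤ C B
  tendsto_iUnion : ∀ A : ℕ → Set T, (∀ n, A n ⊆ A (n + 1)) →
    Tendsto (fun n => C (A n)) atTop (𝓝 (C (⋃ n, A n)))
  tendsto_iInter : ∀ K : ℕ → Set T, (∀ n, K (n + 1) ⊆ K n) → (∀ n, IsCompact (K n)) →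
    Tendsto (fun n => C (K n)) atTop (𝓝 (C (⋂ n, K n)))

/-- A normed Choquet capacity: a Choquet capacity that vanishes on the empty set. -/
structure IsNormedChoquetCapacity {T : Type*} [TopologicalSpace T] (C : Set T → EReal) : Prop
    extends IsChoquetCapacity C where
  empty : C ∅ = 0

/-- Weak partial derivatives in `L^p(Ω)` are unique. -/
theorem HasWeakPartial.unique {N : ℕ} {p : ℝ} (hp : 1 ≤ p) {Ω : Opens (RN N)} {i : Fin N}
    {u g h : LpOn p Ω} (hg : HasWeakPartial i u g) (hh : HasWeakPartial i u h) : g = h := by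
  have hp1 : (1 : ENNReal) ≤ ENNReal.ofReal p := by simpa using ENNReal.ofReal_le_ofReal hp
  have hloc : ∀ w : LpOn p Ω, LocallyIntegrable w (volume.restrict (Ω : Set (RN N))) :=
    fun w => (Lp.memLp w).locallyIntegrable hp1
  have hint : ∀ (w : LpOn p Ω) (φ : RN N → ℝ), Continuous φ → HasCompactSupport φ →
      Integrable (fun x => φ x • w x) (volume.restrict (Ω : Set (RN N))) :=
    fun w φ hc hs => (hloc w).integrable_smul_left_of_hasCompactSupport hc hs
  have key : ∀ᵐ x ∂(volume.restrict (Ω : Set (RN N))), x ∈ (Ω : Set (RN N)) → (g x - h x) = 0 := by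
    refine Ω.isOpen.ae_eq_zero_of_integral_contDiff_smul_eq_zero
      (((hloc g).sub (hloc h)).locallyIntegrableOn _) ?_
    intro φ hφ hs ht
    have h1 := (hg ⟨φ, hφ, hs, ht⟩).symm.trans (hh ⟨φ, hφ, hs, ht⟩)
    have h2 : ∫ x in (Ω : Set (RN N)), φ x • g x = ∫ x in (Ω : Set (RN N)), φ x • h x := by
      simpa [mul_comm] using h1
    simp only [smul_sub]
    rw [integral_sub (hint g φ hφ.continuous hs) (hint h φ hφ.continuous hs), h2, sub_self]
  refine Lp.ext ?_
  filter_upwards [key, ae_restrict_mem Ω.isOpen.measurableSet] with x hx hm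
  exact sub_eq_zero.mp (hx hm)

end RelCap

/-!
`Cap(A)` is the `p`-th power of the distance from `0` to the convex set of functions admissible for
`A`. For `A n` increasing to `A` and the distances bounded, uniform convexity of `W^{1,p}` yields a
point `w` of minimal norm in the intersection of the closures of these convex sets. Taking `z n`
admissible for `A n` with `∑ ‖z n - w‖` small, `w + ∑ |z n - w|` lies above every `z n`, so it is
admissible for `A` and its norm is close to that of `w`; this is (C2).

The argument needs `u ↦ |u|` to act on `W1pTilde` without increasing the norm. For the smooth
functions `√(t² + δ²) - δ` in place of `|t|` this is the chain rule, obtained by mollifying `u`. As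
`δ → 0` only the `L^p` part is seen to converge, but the gradients stay bounded and, once more by
uniform convexity, convex combinations converge in `W^{1,p}`.
-/

namespace RelCap

section UniformConvexity

/-- Quantitative strict midpoint convexity of `‖·‖ ^ p`. Being an inequality between `p`-th powers,
it passes to `L^p` spaces by integration and to finite `ℓ^p` sums by summation. -/
def PowUniformlyConvex (p : ℝ) (E : Type*) [NormedAddCommGroup E] : Prop :=
  ∀ ε : ℝ, 0 < ε → ∃ C : ℝ, 0 ≤ C ∧ ∀ x y : E, ‖x - y‖ ^ p ≤
    ε * (‖x‖ ^ p + ‖y‖ ^ p) + C * ((‖x‖ ^ p + ‖y‖ ^ p) / 2 - (‖x + y‖ / 2) ^ p)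

theorem exists_forall_le_add_mul_of_isCompact {X : Type*} [TopologicalSpace X] {K : Set X}
    (hK : IsCompact K) {f g : X → ℝ} (hf : Continuous f) (hg : Continuous g) (hg0 : ∀ x, 0 ≤ g x)
    (hfg : ∀ x, g x = 0 → f x ≤ 0) {ε : ℝ} (hε : 0 < ε) :
    ∃ C : ℝ, 0 ≤ C ∧ ∀ x ∈ K, f x ≤ ε + C * g x := by
  obtain ⟨n, hn⟩ := hK.elim_directed_cover (fun n : ℕ => {x | f x < ε + n * g x})
    (fun n => isOpen_lt hf (by fun_prop))
    (fun x _ => by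
      rcases (hg0 x).eq_or_lt with hgx | hgx
      · exact Set.mem_iUnion.mpr ⟨0, by simpa using (hfg x hgx.symm).trans_lt hε⟩
      · obtain ⟨n, hn⟩ := exists_nat_gt (f x / g x)
        exact Set.mem_iUnion.mpr ⟨n, ((div_lt_iff₀ hgx).mp hn).trans (lt_add_of_pos_left _ hε)⟩)
    (directed_of_isDirected_le fun m n hmn x (hx : f x < _) =>
      show f x < _ from hx.trans_le (by gcongr; exact hg0 x))
  exact ⟨n, n.cast_nonneg, fun x hx => (hn hx).le⟩

section StrictConvexSpace

variable {E : Type*} [NormedAddCommGroup E] [NormedSpace ℝ E] [StrictConvexSpace ℝ E] {p : ℝ}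

theorem norm_add_div_two_rpow_lt (hp : 1 < p) {x y : E} (hxy : x ≠ y) :
    (‖x + y‖ / 2) ^ p < (‖x‖ ^ p + ‖y‖ ^ p) / 2 := by
  have hp0 : 0 < p := one_pos.trans hp
  by_cases hnorm : ‖x‖ = ‖y‖
  · have hmid : ‖x + y‖ / 2 < ‖x‖ := by
      have := (norm_midpoint_lt_iff hnorm).mpr hxy
      rwa [norm_smul, Real.norm_of_nonneg one_half_pos.le, one_div_mul_eq_div] at this
    calc (‖x + y‖ / 2) ^ p < ‖x‖ ^ p := Real.rpow_lt_rpow (by positivity) hmid hp0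
      _ = (‖x‖ ^ p + ‖y‖ ^ p) / 2 := by rw [← hnorm]; ring
  · have hconv := (strictConvexOn_rpow hp).2 (Set.mem_Ici.mpr (norm_nonneg x))
      (Set.mem_Ici.mpr (norm_nonneg y)) hnorm one_half_pos one_half_pos (add_halves 1)
    calc (‖x + y‖ / 2) ^ p ≤ ((1 / 2 : ℝ) • ‖x‖ + (1 / 2 : ℝ) • ‖y‖) ^ p := by
          refine Real.rpow_le_rpow (by positivity) ?_ hp0.le
          linarith [norm_add_le x y, smul_eq_mul (1 / 2 : ℝ) ‖x‖, smul_eq_mul (1 / 2 : ℝ) ‖y‖]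
      _ < (1 / 2 : ℝ) • ‖x‖ ^ p + (1 / 2 : ℝ) • ‖y‖ ^ p := hconv
      _ = (‖x‖ ^ p + ‖y‖ ^ p) / 2 := by simp only [smul_eq_mul]; ring

theorem exists_norm_sub_rpow_le_of_norm_eq_one [ProperSpace E] (hp : 1 < p) {ε : ℝ} (hε : 0 < ε) :
    ∃ C : ℝ, 0 ≤ C ∧ ∀ z : E × E, ‖z‖ = 1 →
      ‖z.1 - z.2‖ ^ p ≤ ε + C * ((‖z.1‖ ^ p + ‖z.2‖ ^ p) / 2 - (‖z.1 + z.2‖ / 2) ^ p) := by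
  have hp0 : 0 < p := one_pos.trans hp
  have hpow : Continuous fun t : ℝ => t ^ p := Real.continuous_rpow_const hp0.le
  have hgap : ∀ z : E × E, z.1 ≠ z.2 → 0 < (‖z.1‖ ^ p + ‖z.2‖ ^ p) / 2 - (‖z.1 + z.2‖ / 2) ^ p :=
    fun z hz => sub_pos.mpr (norm_add_div_two_rpow_lt hp hz)
  have hdiag : ∀ x : E, (‖x + x‖ / 2) ^ p = (‖x‖ ^ p + ‖x‖ ^ p) / 2 := fun x => by
    rw [← two_smul ℝ x, norm_smul, Real.norm_two, mul_div_cancel_left₀ _ two_ne_zero,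
      add_self_div_two]
  obtain ⟨C, hC, hsphere⟩ := exists_forall_le_add_mul_of_isCompact
    (isCompact_sphere (0 : E × E) 1) (f := fun z => ‖z.1 - z.2‖ ^ p)
    (g := fun z => (‖z.1‖ ^ p + ‖z.2‖ ^ p) / 2 - (‖z.1 + z.2‖ / 2) ^ p)
    (hpow.comp (by fun_prop))
    ((((hpow.comp (by fun_prop)).add (hpow.comp (by fun_prop))).div_const 2).sub
      (hpow.comp (by fun_prop)))
    (fun z => by
      by_cases hz : z.1 = z.2
      · rw [hz, hdiag, sub_self]
      · exact (hgap z hz).le)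
    (fun z hz => by
      have hz' : z.1 = z.2 := by_contra fun h => (hgap z h).ne' hz
      rw [hz', sub_self, norm_zero, Real.zero_rpow hp0.ne'])
    hε
  exact ⟨C, hC, fun z hz => hsphere z (mem_sphere_zero_iff_norm.mpr hz)⟩

theorem powUniformlyConvex_of_strictConvexSpace [ProperSpace E] (hp : 1 < p) :
    PowUniformlyConvex p E := by
  intro ε hε
  have hp0 : 0 < p := one_pos.trans hp
  obtain ⟨C, hC, hsphere⟩ := exists_norm_sub_rpow_le_of_norm_eq_one (E := E) hp hε
  have hunit : ∀ z : E × E, ‖z‖ = 1 → ‖z.1 - z.2‖ ^ p ≤ ε * (‖z.1‖ ^ p + ‖z.2‖ ^ p) +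
      C * ((‖z.1‖ ^ p + ‖z.2‖ ^ p) / 2 - (‖z.1 + z.2‖ / 2) ^ p) := by
    intro z hz
    have hsum : 1 ≤ ‖z.1‖ ^ p + ‖z.2‖ ^ p := by
      rcases max_choice ‖z.1‖ ‖z.2‖ with h | h
      · rw [← h, ← Prod.norm_def, hz, Real.one_rpow]
        exact le_add_of_nonneg_right (by positivity)
      · rw [← h, ← Prod.norm_def, hz, Real.one_rpow]
        exact le_add_of_nonneg_left (by positivity)
    exact (hsphere z hz).trans (by gcongr; exact le_mul_of_one_le_right hε.le hsum)
  refine ⟨C, hC, fun x y => ?_⟩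
  rcases eq_or_ne (x, y) 0 with hz | hz
  · obtain ⟨rfl, rfl⟩ := Prod.mk_eq_zero.mp hz
    simp [Real.zero_rpow hp0.ne']
  · set s : ℝ := ‖(x, y)‖ with hs
    have hs0 : 0 < s := norm_pos_iff.mpr hz
    have hscale : ∀ v : E, ‖s⁻¹ • v‖ ^ p = (s ^ p)⁻¹ * ‖v‖ ^ p := fun v => by
      rw [norm_smul, norm_inv, Real.norm_of_nonneg hs0.le,
        Real.mul_rpow (by positivity) (norm_nonneg v), Real.inv_rpow hs0.le]
    have h := hunit (s⁻¹ • (x, y)) (by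
      rw [norm_smul, norm_inv, Real.norm_of_nonneg hs0.le, ← hs, inv_mul_cancel₀ hs0.ne'])
    simp only [Prod.smul_mk, ← smul_sub, ← smul_add,
      Real.div_rpow (norm_nonneg _) zero_le_two, hscale] at h ⊢
    rw [← mul_le_mul_iff_right₀ (inv_pos.mpr (Real.rpow_pos_of_pos hs0 p))]
    exact h.trans_eq (by ring)

end StrictConvexSpace

variable {p : ℝ} {E : Type*} [NormedAddCommGroup E]

theorem integrable_norm_rpow_Lp {α : Type*} [MeasurableSpace α] {μ : Measure α} (hp : 0 < p)
    (f : Lp E (ENNReal.ofReal p) μ) : Integrable (fun x => ‖f x‖ ^ p) μ := by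
  simpa only [ENNReal.toReal_ofReal hp.le] using
    (Lp.memLp f).integrable_norm_rpow (ENNReal.ofReal_pos.mpr hp).ne' ENNReal.ofReal_ne_top

theorem norm_Lp_rpow_eq_integral {α : Type*} [MeasurableSpace α] {μ : Measure α} (hp : 0 < p)
    (f : Lp E (ENNReal.ofReal p) μ) : ‖f‖ ^ p = ∫ x, ‖f x‖ ^ p ∂μ := by
  have hnonneg : 0 ≤ ∫ x, ‖f x‖ ^ p ∂μ := integral_nonneg fun x => by positivity
  rw [Lp.norm_def, (Lp.memLp f).eLpNorm_eq_integral_rpow_norm (ENNReal.ofReal_pos.mpr hp).ne'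
    ENNReal.ofReal_ne_top, ENNReal.toReal_ofReal hp.le, ENNReal.toReal_ofReal (by positivity),
    Real.rpow_inv_rpow hnonneg hp.ne']

theorem norm_piLp_rpow_eq_sum {ι : Type*} [Fintype ι] (hp : 0 < p)
    (x : PiLp (ENNReal.ofReal p) fun _ : ι => E) : ‖x‖ ^ p = ∑ j, ‖x j‖ ^ p := by
  rw [PiLp.norm_eq_sum (by rwa [ENNReal.toReal_ofReal hp.le]), ENNReal.toReal_ofReal hp.le, one_div,
    Real.rpow_inv_rpow (Finset.sum_nonneg fun j _ => by positivity) hp.ne']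

namespace PowUniformlyConvex

theorem lp [Fact (1 ≤ ENNReal.ofReal p)] {α : Type*} [MeasurableSpace α] {μ : Measure α}
    (hE : PowUniformlyConvex p E) : PowUniformlyConvex p (Lp E (ENNReal.ofReal p) μ) := by
  intro ε hε
  have hp : 0 < p := one_pos.trans_le (ENNReal.one_le_ofReal.mp Fact.out)
  obtain ⟨C, hC, hpointwise⟩ := hE ε hε
  refine ⟨C, hC, fun f g => ?_⟩
  have hf := integrable_norm_rpow_Lp hp f
  have hg := integrable_norm_rpow_Lp hp g
  have hsum_ae : (fun x => ‖(f + g) x‖ ^ p / 2 ^ p) =ᵐ[μ] fun x => (‖f x + g x‖ / 2) ^ p := by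
    filter_upwards [Lp.coeFn_add f g] with x hx
    rw [hx, Pi.add_apply, Real.div_rpow (norm_nonneg _) zero_le_two]
  have hsum : Integrable (fun x => (‖f x + g x‖ / 2) ^ p) μ :=
    ((integrable_norm_rpow_Lp hp (f + g)).div_const (2 ^ p)).congr hsum_ae
  have hsum_eq : (‖f + g‖ / 2) ^ p = ∫ x, (‖f x + g x‖ / 2) ^ p ∂μ := by
    rw [Real.div_rpow (norm_nonneg _) zero_le_two, norm_Lp_rpow_eq_integral hp, ← integral_div,
      integral_congr_ae hsum_ae]
  have hfg : Integrable (fun x => ‖f x‖ ^ p + ‖g x‖ ^ p) μ := hf.add hg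
  have hgap : Integrable (fun x => (‖f x‖ ^ p + ‖g x‖ ^ p) / 2 - (‖f x + g x‖ / 2) ^ p) μ :=
    (hfg.div_const 2).sub hsum
  calc ‖f - g‖ ^ p = ∫ x, ‖(f - g) x‖ ^ p ∂μ := norm_Lp_rpow_eq_integral hp _
    _ ≤ ∫ x, (ε * (‖f x‖ ^ p + ‖g x‖ ^ p) +
          C * ((‖f x‖ ^ p + ‖g x‖ ^ p) / 2 - (‖f x + g x‖ / 2) ^ p)) ∂μ := by
        refine integral_mono_ae (integrable_norm_rpow_Lp hp _)
          ((hfg.const_mul ε).add (hgap.const_mul C)) ?_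
        filter_upwards [Lp.coeFn_sub f g] with x hx
        rw [hx]
        exact hpointwise (f x) (g x)
    _ = _ := by
        rw [integral_add (hfg.const_mul ε) (hgap.const_mul C), integral_const_mul,
          integral_const_mul, integral_sub (hfg.div_const 2) hsum, integral_div, integral_add hf hg,
          norm_Lp_rpow_eq_integral hp, norm_Lp_rpow_eq_integral hp, hsum_eq]

theorem piLp [Fact (1 ≤ ENNReal.ofReal p)] {ι : Type*} [Fintype ι]
    (hE : PowUniformlyConvex p E) :
    PowUniformlyConvex p (PiLp (ENNReal.ofReal p) fun _ : ι => E) := by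
  intro ε hε
  have hp : 0 < p := one_pos.trans_le (ENNReal.one_le_ofReal.mp Fact.out)
  obtain ⟨C, hC, hcoord⟩ := hE ε hε
  refine ⟨C, hC, fun x y => ?_⟩
  rw [Real.div_rpow (norm_nonneg _) zero_le_two]
  simp only [norm_piLp_rpow_eq_sum hp]
  rw [← Finset.sum_add_distrib, Finset.mul_sum, Finset.sum_div, Finset.sum_div,
    ← Finset.sum_sub_distrib, Finset.mul_sum, ← Finset.sum_add_distrib]
  refine Finset.sum_le_sum fun j _ => ?_
  rw [← Real.div_rpow (norm_nonneg _) zero_le_two]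
  exact hcoord (x j) (y j)

theorem uniformConvexSpace (hp : 1 ≤ p) (hE : PowUniformlyConvex p E) : UniformConvexSpace E := by
  have hp0 : 0 < p := one_pos.trans_le hp
  refine ⟨fun ε hε => ?_⟩
  obtain ⟨C, hC, hbound⟩ := hE (ε ^ p / 4) (by positivity)
  set c : ℝ := ε ^ p / (2 * (C + 1)) with hc
  have hc0 : 0 < c := by positivity
  refine ⟨2 * c / p, by positivity, fun x hx y hy hxy => ?_⟩
  have hC1 : c * (C + 1) = ε ^ p / 2 := by rw [hc]; field_simp
  have hpow : ε ^ p ≤ ‖x - y‖ ^ p := Real.rpow_le_rpow hε.le hxy hp0.le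
  have hmid : (‖x + y‖ / 2) ^ p ≤ 1 - c := by
    have h := hbound x y
    rw [hx, hy, Real.one_rpow] at h
    by_contra! hlt
    nlinarith
  have hbernoulli : 1 + p * (‖x + y‖ / 2 - 1) ≤ (‖x + y‖ / 2) ^ p := by
    have h := one_add_mul_self_le_rpow_one_add
      (s := ‖x + y‖ / 2 - 1) (by linarith [norm_nonneg (x + y)]) hp
    rwa [add_sub_cancel] at h
  have hmul : p * (1 - ‖x + y‖ / 2) ≥ c := by linarith
  have hdiv : c / p ≤ 1 - ‖x + y‖ / 2 := (div_le_iff₀' hp0).mpr hmul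
  linarith [mul_div_assoc 2 c p]

end PowUniformlyConvex

end UniformConvexity

section UniformConvexSpace

variable {E : Type*} [NormedAddCommGroup E] [NormedSpace ℝ E] [UniformConvexSpace E]

theorem exists_norm_add_le_two_mul_sub {ε r : ℝ} (hε : 0 < ε) (hr : 0 ≤ r) :
    ∃ δ : ℝ, 0 < δ ∧ ∀ x y : E, ‖x‖ ≤ r + δ → ‖y‖ ≤ r + δ → ε ≤ ‖x - y‖ →
      ‖x + y‖ ≤ 2 * r - δ := by
  obtain ⟨δ, hδ, hball⟩ := exists_forall_closed_ball_dist_add_le_two_mul_sub E (half_pos hε) r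
  refine ⟨min (δ / 3) (ε / 4), by positivity, fun x y hx hy hxy => ?_⟩
  set η := min (δ / 3) (ε / 4)
  have hηδ : η ≤ δ / 3 := min_le_left _ _
  have hηε : η ≤ ε / 4 := min_le_right _ _
  have hη : 0 ≤ η := by positivity
  have hproj : ∀ v : E, ‖v‖ ≤ r + η → ∃ v' : E, ‖v - v'‖ ≤ η ∧ ‖v'‖ ≤ r := fun v hv => by
    simpa only [dist_eq_norm, sub_zero] using
      exists_dist_le_le (x := v) (z := 0) hη hr (by simpa only [dist_zero_right, add_comm])
  obtain ⟨x', hxx', hx'⟩ := hproj x hx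
  obtain ⟨y', hyy', hy'⟩ := hproj y hy
  have hfar : ε / 2 ≤ ‖x' - y'‖ := by
    have : ‖x - y‖ ≤ ‖x - x'‖ + ‖x' - y'‖ + ‖y - y'‖ := by
      rw [norm_sub_rev y y']
      exact (norm_sub_le_norm_sub_add_norm_sub x y' y).trans
        (by gcongr; exact norm_sub_le_norm_sub_add_norm_sub x x' y')
    linarith
  calc ‖x + y‖ = ‖(x' + y') + ((x - x') + (y - y'))‖ := by congr 1; abel
    _ ≤ ‖x' + y'‖ + (‖x - x'‖ + ‖y - y'‖) :=
      (norm_add_le _ _).trans (by gcongr; exact norm_add_le _ _)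
    _ ≤ 2 * r - η := by linarith [hball hx' hy' hfar]

variable [CompleteSpace E]

theorem exists_mem_iInter_closure_norm_le {K : ℕ → Set E} (hK : Antitone K)
    (hconv : ∀ n, Convex ℝ (K n)) (hne : ∀ n, (K n).Nonempty) {r : ℝ}
    (hr : ∀ n, Metric.infDist 0 (K n) ≤ r) : ∃ w ∈ ⋂ n, closure (K n), ‖w‖ ≤ r := by
  have hmono : Monotone fun n => Metric.infDist (0 : E) (K n) := fun m n hmn =>
    Metric.infDist_le_infDist_of_subset (hK hmn) (hne n)
  have hbdd : BddAbove (Set.range fun n => Metric.infDist (0 : E) (K n)) :=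
    ⟨r, Set.forall_mem_range.mpr hr⟩
  set L : ℝ := ⨆ n, Metric.infDist (0 : E) (K n)
  have hlim : Tendsto (fun n => Metric.infDist (0 : E) (K n)) atTop (𝓝 L) :=
    tendsto_atTop_ciSup hmono hbdd
  have hleL : ∀ n, Metric.infDist (0 : E) (K n) ≤ L := le_ciSup hbdd
  have hL0 : 0 ≤ L := Metric.infDist_nonneg.trans (hleL 0)
  have hnear : ∀ n : ℕ, ∃ z ∈ K n, ‖z‖ < L + 1 / ((n : ℝ) + 1) := fun n => by
    simpa only [dist_zero_left] using (Metric.infDist_lt_iff (hne n)).mp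
      ((hleL n).trans_lt (lt_add_of_pos_right L Nat.one_div_pos_of_nat))
  choose z hzK hz using hnear
  have hcauchy : CauchySeq z := by
    refine Metric.cauchySeq_iff'.mpr fun ε hε => ?_
    obtain ⟨δ, hδ, hmid⟩ := exists_norm_add_le_two_mul_sub (E := E) hε hL0
    obtain ⟨n, hδn, hLn⟩ := ((tendsto_one_div_add_atTop_nhds_zero_nat.eventually_lt_const hδ).and
      (hlim.eventually_const_lt (sub_lt_self L (half_pos hδ)))).exists
    refine ⟨n, fun k hk => ?_⟩
    have hzδ : ∀ m ≥ n, ‖z m‖ ≤ L + δ := fun m hm =>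
      (hz m).le.trans (by gcongr; exact (Nat.one_div_le_one_div hm).trans hδn.le)
    have hmem : (1 / 2 : ℝ) • z k + (1 / 2 : ℝ) • z n ∈ K n :=
      hconv n (hK hk (hzK k)) (hzK n) (by norm_num) (by norm_num) (by norm_num)
    have hsum : 2 * Metric.infDist (0 : E) (K n) ≤ ‖z k + z n‖ := by
      have h := Metric.infDist_le_dist_of_mem (x := 0) hmem
      rw [dist_zero_left, ← smul_add, norm_smul, Real.norm_of_nonneg one_half_pos.le] at h
      linarith
    rw [dist_eq_norm]
    by_contra! hfar
    linarith [hmid (z k) (z n) (hzδ k hk) (hzδ n le_rfl) hfar]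
  obtain ⟨w, hw⟩ := cauchySeq_tendsto_of_complete hcauchy
  refine ⟨w, Set.mem_iInter.mpr fun n => mem_closure_of_tendsto hw ?_, ?_⟩
  · filter_upwards [eventually_ge_atTop n] with k hk using hK hk (hzK k)
  · have hL : Tendsto (fun n : ℕ => L + 1 / ((n : ℝ) + 1)) atTop (𝓝 L) := by
      simpa using tendsto_one_div_add_atTop_nhds_zero_nat.const_add L
    exact (le_of_tendsto_of_tendsto' hw.norm hL fun n => (hz n).le).trans (ciSup_le hr)

theorem infEDist_zero_iInter_closure {K : ℕ → Set E} (hK : Antitone K)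
    (hconv : ∀ n, Convex ℝ (K n)) :
    Metric.infEDist 0 (⋂ n, closure (K n)) = ⨆ n, Metric.infEDist 0 (K n) := by
  refine le_antisymm ?_ (iSup_le fun n => ?_)
  · set L : ENNReal := ⨆ n, Metric.infEDist (0 : E) (K n)
    rcases eq_or_ne L ⊤ with hL | hL
    · exact hL ▸ le_top
    have hle : ∀ n, Metric.infEDist (0 : E) (K n) ≤ L := le_iSup _
    have hne : ∀ n, (K n).Nonempty := fun n => Set.nonempty_iff_ne_empty.mpr fun hempty =>
      hL (top_unique ((Metric.infEDist_empty (x := (0 : E))).ge.trans (hempty ▸ hle n)))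
    obtain ⟨w, hw, hwL⟩ := exists_mem_iInter_closure_norm_le hK hconv hne
      fun n => ENNReal.toReal_mono hL (hle n)
    calc Metric.infEDist 0 (⋂ n, closure (K n)) ≤ edist 0 w := Metric.infEDist_le_edist_of_mem hw
      _ = ENNReal.ofReal ‖w‖ := by rw [edist_dist, dist_zero_left]
      _ ≤ L := ENNReal.ofReal_le_of_le_toReal hwL
  · rw [← Metric.infEDist_closure (s := K n)]
    exact Metric.infEDist_anti (Set.iInter_subset _ n)

theorem exists_mem_map_eq_norm_le {F : Type*} [NormedAddCommGroup F] [NormedSpace ℝ F]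
    (π : E →L[ℝ] F) {S : Set E} (hS : IsClosed S) (hconv : Convex ℝ S) {w : ℕ → E} {R : ℕ → ℝ}
    {a : F} {r : ℝ} (hwS : ∀ n, w n ∈ S) (hwR : ∀ n, ‖w n‖ ≤ R n) (hR : Tendsto R atTop (𝓝 r))
    (hπ : Tendsto (fun n => π (w n)) atTop (𝓝 a)) : ∃ y ∈ S, π y = a ∧ ‖y‖ ≤ r := by
  set K : ℕ → Set E := fun n => convexHull ℝ (w '' Set.Ici n)
  have hmem : ∀ {n m}, n ≤ m → w m ∈ K n := fun h => subset_convexHull ℝ _ ⟨_, h, rfl⟩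
  have hdist : ∀ n, Metric.infDist 0 (K n) ≤ r := fun n => ge_of_tendsto hR <| by
    filter_upwards [eventually_ge_atTop n] with m hm
    exact (Metric.infDist_le_dist_of_mem (hmem hm)).trans (by simpa using hwR m)
  obtain ⟨y, hy, hyr⟩ := exists_mem_iInter_closure_norm_le
    (fun m n h => convexHull_mono (Set.image_mono (Set.Ici_subset_Ici.mpr h)))
    (fun n => convex_convexHull ℝ _) (fun n => ⟨w n, hmem le_rfl⟩) hdist
  rw [Set.mem_iInter] at hy
  have hclosed : ∀ {C : Set E}, IsClosed C → Convex ℝ C → (∀ᶠ n in atTop, w n ∈ C) → y ∈ C := by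
    intro C hC hCconv hev
    obtain ⟨n, hn⟩ := eventually_atTop.mp hev
    exact closure_minimal (convexHull_min (Set.image_subset_iff.mpr hn) hCconv) hC (hy n)
  refine ⟨y, hclosed hS hconv (.of_forall hwS), ?_, hyr⟩
  refine dist_le_zero.mp (le_of_forall_pos_le_add fun ε hε => ?_)
  have hball : y ∈ π ⁻¹' Metric.closedBall a ε :=
    hclosed (Metric.isClosed_closedBall.preimage π.continuous)
      ((convex_closedBall a ε).linear_preimage π.toLinearMap)
      (hπ.eventually (Metric.closedBall_mem_nhds a hε))
  rwa [zero_add]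

end UniformConvexSpace

section Mollification

open scoped Convolution ContDiff
open ContinuousLinearMap (lsmul)

variable {E : Type*} [NormedAddCommGroup E] [NormedSpace ℝ E] [FiniteDimensional ℝ E]
  [MeasurableSpace E] [BorelSpace E] {μ : Measure E} [μ.IsAddHaarMeasure]

/-- The mollification of `f`, that is, its average against the normalized bump function `ρ`. -/
noncomputable def mollify (ρ : ContDiffBump (0 : E)) (μ : Measure E) (f : E → ℝ) : E → ℝ :=
  ρ.normed μ ⋆[lsmul ℝ ℝ, μ] f

variable (ρ : ContDiffBump (0 : E)) {f b : E → ℝ}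

theorem contDiff_mollify (hf : LocallyIntegrable f μ) : ContDiff ℝ ∞ (mollify ρ μ f) :=
  ρ.hasCompactSupport_normed.contDiff_convolution_left _ ρ.contDiff_normed hf

theorem hasCompactSupport_mollify (hb : HasCompactSupport b) :
    HasCompactSupport (mollify ρ μ b) :=
  ρ.hasCompactSupport_normed.convolution _ hb

theorem tsupport_mollify_subset :
    tsupport (mollify ρ μ b) ⊆ Metric.cthickening ρ.rOut (tsupport b) := by
  refine closure_minimal ((support_convolution_subset _).trans ?_) Metric.isClosed_cthickening
  rintro _ ⟨y, hy, z, hz, rfl⟩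
  rw [ρ.support_normed_eq, mem_ball_zero_iff] at hy
  exact Metric.mem_cthickening_of_dist_le _ z _ _ (subset_tsupport b hz) (by simpa using hy.le)

theorem abs_mollify_le (hf : AEStronglyMeasurable f μ) {x : E} {M : ℝ}
    (hM : ∀ y ∈ Metric.ball x ρ.rOut, |f y| ≤ M) : |mollify ρ μ f x| ≤ M := by
  have hM0 : 0 ≤ M := (abs_nonneg _).trans (hM x (Metric.mem_ball_self ρ.rOut_pos))
  simpa only [mollify, dist_zero_right, Real.norm_eq_abs] using
    dist_convolution_le (z₀ := 0) hM0 ρ.support_normed_eq.subset ρ.nonneg_normed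
      ρ.integral_normed hf (by simpa only [dist_zero_right, Real.norm_eq_abs] using hM)

theorem integral_mul_mollify (hf : Continuous f) (hb : Continuous b) (hbs : HasCompactSupport b) :
    ∫ x, f x * mollify ρ μ b x ∂μ = ∫ x, mollify ρ μ f x * b x ∂μ := by
  simp only [mollify, convolution_lsmul_swap, smul_eq_mul, ← integral_const_mul,
    ← integral_mul_const]
  rw [integral_integral_swap_of_hasCompactSupport]
  · refine integral_congr_ae (.of_forall fun y => integral_congr_ae (.of_forall fun x => ?_))
    simp only
    rw [← ρ.normed_neg (x - y), neg_sub]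
    ring
  · have := ρ.continuous_normed (μ := μ)
    fun_prop
  · refine HasCompactSupport.intro
      ((hbs.isCompact.add (ρ.hasCompactSupport_normed (μ := μ)).isCompact).prod hbs.isCompact) ?_
    rintro ⟨x, y⟩ hxy
    simp only [Function.uncurry]
    by_cases hy : y ∈ tsupport b
    · have hxy' : x - y ∉ tsupport (ρ.normed μ) := fun h =>
        hxy ⟨⟨y, hy, x - y, h, add_sub_cancel y x⟩, hy⟩
      rw [image_eq_zero_of_notMem_tsupport hxy', zero_mul, mul_zero]
    · rw [image_eq_zero_of_notMem_tsupport hy, mul_zero, mul_zero]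

theorem fderiv_mollify_apply (hb : ContDiff ℝ 1 b) (hbs : HasCompactSupport b) (x v : E) :
    fderiv ℝ (mollify ρ μ b) x v = mollify ρ μ (fun y => fderiv ℝ b y v) x := by
  have hρ : LocallyIntegrable (ρ.normed μ) μ := ρ.continuous_normed.locallyIntegrable
  rw [mollify, (hbs.hasFDerivAt_convolution_right (lsmul ℝ ℝ) hρ hb x).fderiv]
  exact convolution_precompR_apply (lsmul ℝ ℝ) hρ (hbs.fderiv ℝ)
    (hb.continuous_fderiv one_ne_zero) x v

variable {ρ : ℕ → ContDiffBump (0 : E)}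

theorem tendsto_mollify (hρ : Tendsto (fun n => (ρ n).rOut) atTop (𝓝 0)) {b : ℕ → E → ℝ}
    (hb : ∀ n, Continuous (b n)) {x : E} {y : ℝ}
    (hlim : Tendsto (Function.uncurry b) (atTop ×ˢ 𝓝 x) (𝓝 y)) :
    Tendsto (Function.uncurry fun n => mollify (ρ n) μ (b n)) (atTop ×ˢ 𝓝 x) (𝓝 y) :=
  ContDiffBump.convolution_tendsto_right (φ := fun i : ℕ × E => ρ i.1) (g := fun i => b i.1)
    (hρ.comp tendsto_fst) (.of_forall fun i => (hb i.1).aestronglyMeasurable)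
    (hlim.comp ((tendsto_fst.comp tendsto_fst).prodMk tendsto_snd)) tendsto_snd

theorem tendsto_mollify_apply (hρ : Tendsto (fun n => (ρ n).rOut) atTop (𝓝 0)) (hf : Continuous f)
    (x : E) : Tendsto (fun n => mollify (ρ n) μ f x) atTop (𝓝 (f x)) :=
  ContDiffBump.convolution_tendsto_right_of_continuous hρ hf x

theorem exists_abs_comp_mollify_le (hf : Continuous f) {h : ℝ → ℝ} (hh : Continuous h) {K : Set E}
    (hK : IsCompact K) : ∃ H : ℝ, ∀ ρ : ContDiffBump (0 : E), ρ.rOut ≤ 1 →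
      ∀ x ∈ K, |h (mollify ρ μ f x)| ≤ H := by
  obtain ⟨M, hM⟩ := (hK.cthickening (r := 1)).exists_bound_of_continuousOn hf.continuousOn
  obtain ⟨H, hH⟩ := (isCompact_Icc (a := -M) (b := M)).exists_bound_of_continuousOn hh.continuousOn
  refine ⟨H, fun ρ hρ x hx => hH _ (abs_le.mp ?_)⟩
  refine abs_mollify_le ρ hf.aestronglyMeasurable fun y hy => hM y ?_
  exact Metric.mem_cthickening_of_dist_le y x 1 K hx ((Metric.mem_ball.mp hy).le.trans hρ)

theorem exists_abs_comp_mollify_mul_le (hf : Continuous f) {h : ℝ → ℝ} (hh : Continuous h)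
    {c : E → ℝ} (hc : Continuous c) (hcs : HasCompactSupport c) :
    ∃ B : ℝ, ∀ ρ : ContDiffBump (0 : E), ρ.rOut ≤ 1 →
      ∀ x, |h (mollify ρ μ f x) * c x| ≤ B := by
  obtain ⟨H, hH⟩ := exists_abs_comp_mollify_le (μ := μ) hf hh hcs.isCompact
  obtain ⟨C, hC⟩ := hcs.exists_bound_of_continuous hc
  refine ⟨|H| * C, fun ρ hρ x => ?_⟩
  by_cases hx : x ∈ tsupport c
  · rw [abs_mul]
    exact mul_le_mul ((hH ρ hρ x hx).trans (le_abs_self H)) (hC x) (abs_nonneg _) (abs_nonneg _)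
  · rw [image_eq_zero_of_notMem_tsupport hx, mul_zero, abs_zero]
    exact mul_nonneg (abs_nonneg H) ((norm_nonneg _).trans (hC x))

theorem tendsto_integral_comp_mollify_mul (hρ : Tendsto (fun n => (ρ n).rOut) atTop (𝓝 0))
    (hf : Continuous f) {h : ℝ → ℝ} (hh : Continuous h) {c : E → ℝ} (hc : Continuous c)
    (hcs : HasCompactSupport c) :
    Tendsto (fun n => ∫ x, h (mollify (ρ n) μ f x) * c x ∂μ) atTop
      (𝓝 (∫ x, h (f x) * c x ∂μ)) := by
  obtain ⟨H, hH⟩ := exists_abs_comp_mollify_le (μ := μ) hf hh hcs.isCompact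
  refine tendsto_integral_filter_of_dominated_convergence (fun x => H * ‖c x‖) ?_ ?_
    ((hc.integrable_of_hasCompactSupport hcs).norm.const_mul H) ?_
  · exact .of_forall fun n => ((hh.comp (contDiff_mollify _
      hf.locallyIntegrable).continuous).mul hc).aestronglyMeasurable
  · filter_upwards [hρ.eventually_le_const one_pos] with n hn
    refine .of_forall fun x => ?_
    by_cases hx : x ∈ tsupport c
    · rw [norm_mul]
      gcongr
      exact hH _ hn x hx
    · rw [image_eq_zero_of_notMem_tsupport hx, mul_zero, norm_zero, mul_zero]
  · exact .of_forall fun x =>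
      ((hh.tendsto _).comp (tendsto_mollify_apply hρ hf x)).mul_const (c x)

theorem tendsto_setIntegral_mul_mollify (hρ : Tendsto (fun n => (ρ n).rOut) atTop (𝓝 0))
    {Ω : Opens E} {g : E → ℝ} (hg : LocallyIntegrableOn g Ω μ) {K : Set E} (hK : IsCompact K)
    (hKΩ : K ⊆ Ω) {b : ℕ → E → ℝ} (hb : ∀ n, Continuous (b n)) (hbK : ∀ n, tsupport (b n) ⊆ K)
    {B : ℝ} (hB : ∀ᶠ n in atTop, ∀ x, |b n x| ≤ B) {c : E → ℝ}
    (hlim : ∀ x, Tendsto (Function.uncurry b) (atTop ×ˢ 𝓝 x) (𝓝 (c x))) :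
    Tendsto (fun n => ∫ x in Ω, g x * mollify (ρ n) μ (b n) x ∂μ) atTop
      (𝓝 (∫ x in Ω, g x * c x ∂μ)) := by
  obtain ⟨δ, hδ, hδΩ⟩ := hK.exists_cthickening_subset_open Ω.isOpen hKΩ
  have hKδ : IsCompact (Metric.cthickening δ K) := hK.cthickening
  have hcont : ∀ n, Continuous (mollify (ρ n) μ (b n)) := fun n =>
    (contDiff_mollify _ (hb n).locallyIntegrable).continuous
  refine tendsto_integral_filter_of_dominated_convergence
    ((Metric.cthickening δ K).indicator fun x => ‖g x‖ * B) ?_ ?_ ?_ ?_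
  · exact .of_forall fun n => hg.aestronglyMeasurable.mul (hcont n).aestronglyMeasurable
  · filter_upwards [hB, hρ.eventually_le_const hδ] with n hBn hn
    refine .of_forall fun x => ?_
    by_cases hx : x ∈ Metric.cthickening δ K
    · rw [Set.indicator_of_mem hx, norm_mul]
      gcongr
      exact abs_mollify_le _ (hb n).aestronglyMeasurable fun y _ => hBn y
    · have hx' : x ∉ tsupport (mollify (ρ n) μ (b n)) := fun h =>
        hx ((tsupport_mollify_subset _).trans
          ((Metric.cthickening_mono hn _).trans (Metric.cthickening_subset_of_subset δ (hbK n))) h)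
      rw [Set.indicator_of_notMem hx, image_eq_zero_of_notMem_tsupport hx', mul_zero, norm_zero]
  · rw [integrable_indicator_iff hKδ.measurableSet]
    exact ((hg.integrableOn_compact_subset hδΩ hKδ).mono_measure
      Measure.restrict_le_self).norm.mul_const B
  · refine .of_forall fun x => Tendsto.const_mul (g x) ?_
    have hx : Tendsto (fun n : ℕ => (n, x)) atTop (atTop ×ˢ 𝓝 x) :=
      tendsto_id.prodMk tendsto_const_nhds
    simpa only [Function.comp_def, Function.uncurry_apply_pair] using
      (tendsto_mollify (μ := μ) hρ hb (hlim x)).comp hx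

end Mollification

section ChainRule

open scoped ContDiff

variable {E : Type*} [NormedAddCommGroup E] [NormedSpace ℝ E] [MeasurableSpace E] {μ : Measure E}

theorem setIntegral_mul_fderiv_eq_integral {Ω : Opens E} {f c : E → ℝ} (hc : tsupport c ⊆ Ω)
    (v : E) : ∫ x in Ω, f x * fderiv ℝ c x v ∂μ = ∫ x, f x * fderiv ℝ c x v ∂μ := by
  refine setIntegral_eq_integral_of_forall_compl_eq_zero fun x hx => ?_
  rw [image_eq_zero_of_notMem_tsupport (f := fderiv ℝ c)
    fun h => hx (hc (tsupport_fderiv_subset ℝ h)), zero_apply, mul_zero]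

/-- `g` is the derivative of `f` along `v` in the sense of distributions on `Ω`; for Lebesgue
measure and a basis vector `v` this is `HasWeakPartial`, freed from `L^p`. -/
def HasWeakDirDeriv (μ : Measure E) (Ω : Opens E) (v : E) (f g : E → ℝ) : Prop :=
  ∀ φ : TestFunction Ω ℝ ⊤,
    ∫ x in Ω, f x * fderiv ℝ φ x v ∂μ = -∫ x in Ω, g x * φ x ∂μ

theorem HasWeakDirDeriv.congr_ae {Ω : Opens E} {v : E} {f f' g g' : E → ℝ}
    (h : HasWeakDirDeriv μ Ω v f g) (hf : f =ᵐ[μ.restrict Ω] f') (hg : g =ᵐ[μ.restrict Ω] g') :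
    HasWeakDirDeriv μ Ω v f' g' := fun φ => by
  refine (integral_congr_ae ?_).trans ((h φ).trans (congrArg Neg.neg (integral_congr_ae ?_)))
  · filter_upwards [hf] with x hx
    rw [hx]
  · filter_upwards [hg] with x hx
    rw [hx]

variable [FiniteDimensional ℝ E] [BorelSpace E] [μ.IsAddHaarMeasure]

theorem integral_mul_fderiv_eq_neg {a c : E → ℝ} (ha : ContDiff ℝ 1 a) (hc : ContDiff ℝ 1 c)
    (hcs : HasCompactSupport c) (v : E) :
    ∫ x, a x * fderiv ℝ c x v ∂μ = -∫ x, fderiv ℝ a x v * c x ∂μ := by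
  have hderiv : ∀ {d : E → ℝ}, ContDiff ℝ 1 d → Continuous fun x => fderiv ℝ d x v := fun hd =>
    (hd.continuous_fderiv one_ne_zero).clm_apply continuous_const
  have hcs' : HasCompactSupport fun x => fderiv ℝ c x v := hcs.fderiv_apply ℝ v
  exact integral_mul_fderiv_eq_neg_fderiv_mul_of_integrable
    (((hderiv ha).mul hc.continuous).integrable_of_hasCompactSupport hcs.mul_left)
    ((ha.continuous.mul (hderiv hc)).integrable_of_hasCompactSupport hcs'.mul_left)
    ((ha.continuous.mul hc.continuous).integrable_of_hasCompactSupport hcs.mul_left)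
    (fun x _ => ha.differentiable one_ne_zero x) (fun x _ => hc.differentiable one_ne_zero x)

theorem integral_comp_mul_fderiv {u φ : E → ℝ} {h : ℝ → ℝ} (hu : ContDiff ℝ 1 u)
    (hh : ContDiff ℝ 2 h) (hφ : ContDiff ℝ 1 φ) (hφs : HasCompactSupport φ) (v : E) :
    ∫ x, h (u x) * fderiv ℝ φ x v ∂μ =
      ∫ x, u x * fderiv ℝ (fun y => deriv h (u y) * φ y) x v ∂μ := by
  have hh' : ContDiff ℝ 1 (deriv h) := (contDiff_succ_iff_deriv (n := 1).mp hh).2.2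
  have hcomp : ∀ x, fderiv ℝ (fun y => h (u y)) x v = deriv h (u x) * fderiv ℝ u x v := fun x => by
    have hd : HasFDerivAt (fun y => h (u y)) (deriv h (u x) • fderiv ℝ u x) x :=
      (hh.differentiable two_ne_zero (u x)).hasDerivAt.comp_hasFDerivAt x
        (hu.differentiable one_ne_zero x).hasFDerivAt
    rw [hd.fderiv]
    rfl
  calc ∫ x, h (u x) * fderiv ℝ φ x v ∂μ
      = -∫ x, fderiv ℝ (fun y => h (u y)) x v * φ x ∂μ :=
        integral_mul_fderiv_eq_neg ((hh.of_le one_le_two).comp hu) hφ hφs v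
    _ = -∫ x, fderiv ℝ u x v * (deriv h (u x) * φ x) ∂μ := by
        simp only [hcomp]
        congr 2 with x
        ring
    _ = ∫ x, u x * fderiv ℝ (fun y => deriv h (u y) * φ y) x v ∂μ :=
        (integral_mul_fderiv_eq_neg hu ((hh'.comp hu).mul hφ) hφs.mul_left v).symm

variable {Ω : Opens E} {v : E} {f g : E → ℝ}

namespace HasWeakDirDeriv

theorem integral_mollify_mul_fderiv (hfg : HasWeakDirDeriv μ Ω v f g) (hf : Continuous f)
    (ρ : ContDiffBump (0 : E)) {b : E → ℝ} (hb : ContDiff ℝ ∞ b) (hbs : HasCompactSupport b)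
    (hbΩ : Metric.cthickening ρ.rOut (tsupport b) ⊆ Ω) :
    ∫ x, mollify ρ μ f x * fderiv ℝ b x v ∂μ = -∫ x in Ω, g x * mollify ρ μ b x ∂μ := by
  have hb1 : ContDiff ℝ 1 b := hb.of_le (by exact_mod_cast le_top)
  have hsupp : tsupport (mollify ρ μ b) ⊆ Ω := (tsupport_mollify_subset ρ).trans hbΩ
  have htest : ∫ x in Ω, f x * fderiv ℝ (mollify ρ μ b) x v ∂μ =
      -∫ x in Ω, g x * mollify ρ μ b x ∂μ :=
    hfg ⟨mollify ρ μ b, contDiff_mollify ρ hb.continuous.locallyIntegrable,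
      hasCompactSupport_mollify ρ hbs, hsupp⟩
  rw [← htest, setIntegral_mul_fderiv_eq_integral hsupp, ← integral_mul_mollify ρ hf
    ((hb1.continuous_fderiv one_ne_zero).clm_apply continuous_const) (hbs.fderiv_apply ℝ v)]
  simp only [fderiv_mollify_apply ρ hb1 hbs]

theorem integral_comp_mollify_mul_fderiv (hfg : HasWeakDirDeriv μ Ω v f g) (hf : Continuous f)
    {h : ℝ → ℝ} (hh : ContDiff ℝ ∞ h) {φ : E → ℝ} (hφ : ContDiff ℝ ∞ φ) (hφs : HasCompactSupport φ)
    (ρ : ContDiffBump (0 : E)) (hφΩ : Metric.cthickening ρ.rOut (tsupport φ) ⊆ Ω) :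
    ∫ x, h (mollify ρ μ f x) * fderiv ℝ φ x v ∂μ =
      -∫ x in Ω, g x * mollify ρ μ (fun y => deriv h (mollify ρ μ f y) * φ y) x ∂μ := by
  have hU : ContDiff ℝ ∞ (mollify ρ μ f) := contDiff_mollify ρ hf.locallyIntegrable
  rw [integral_comp_mul_fderiv (hU.of_le (by exact_mod_cast le_top)) (contDiff_infty.mp hh 2)
    (hφ.of_le (by exact_mod_cast le_top)) hφs]
  exact hfg.integral_mollify_mul_fderiv hf ρ
    (((contDiff_infty_iff_deriv.mp hh).2.comp hU).mul hφ) hφs.mul_left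
    ((Metric.cthickening_subset_of_subset _ tsupport_mul_subset_right).trans hφΩ)

theorem comp (hfg : HasWeakDirDeriv μ Ω v f g) (hf : Continuous f)
    (hg : LocallyIntegrableOn g Ω μ) {h : ℝ → ℝ} (hh : ContDiff ℝ ∞ h) :
    HasWeakDirDeriv μ Ω v (fun x => h (f x)) (fun x => deriv h (f x) * g x) := by
  intro φ
  let ρ : ℕ → ContDiffBump (0 : E) := fun n =>
    ⟨1 / ((n : ℝ) + 1) / 2, 1 / ((n : ℝ) + 1), by positivity, half_lt_self (by positivity)⟩
  have hρ : Tendsto (fun n => (ρ n).rOut) atTop (𝓝 0) := tendsto_one_div_add_atTop_nhds_zero_nat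
  have hh' : Continuous (deriv h) := hh.continuous_deriv (by simp)
  have hφ1 : ContDiff ℝ 1 φ := φ.contDiff.of_le (by exact_mod_cast le_top)
  let b : ℕ → E → ℝ := fun n x => deriv h (mollify (ρ n) μ f x) * φ x
  have hb : ∀ n, Continuous (b n) := fun n =>
    (hh'.comp (contDiff_mollify _ hf.locallyIntegrable).continuous).mul φ.continuous
  have hbsupp : ∀ n, tsupport (b n) ⊆ tsupport φ := fun n => tsupport_mul_subset_right
  have hblim : ∀ x, Tendsto (Function.uncurry b) (atTop ×ˢ 𝓝 x) (𝓝 (deriv h (f x) * φ x)) :=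
    fun x => ((hh'.tendsto _).comp (tendsto_mollify hρ (fun _ => hf)
      ((hf.tendsto x).comp tendsto_snd))).mul ((φ.continuous.tendsto x).comp tendsto_snd)
  obtain ⟨B, hB⟩ := exists_abs_comp_mollify_mul_le (μ := μ) hf hh' φ.continuous
    φ.hasCompactSupport
  have hleft := tendsto_integral_comp_mollify_mul (μ := μ) hρ hf hh.continuous
    ((hφ1.continuous_fderiv one_ne_zero).clm_apply continuous_const)
    (φ.hasCompactSupport.fderiv_apply ℝ v)
  have hright := tendsto_setIntegral_mul_mollify hρ hg φ.hasCompactSupport.isCompact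
    φ.tsupport_subset hb hbsupp
    ((hρ.eventually_le_const one_pos).mono fun n hn => hB (ρ n) hn) hblim
  obtain ⟨δ, hδ, hδΩ⟩ := φ.hasCompactSupport.isCompact.exists_cthickening_subset_open Ω.isOpen
    φ.tsupport_subset
  have heq : ∀ᶠ n in atTop, ∫ x, h (mollify (ρ n) μ f x) * fderiv ℝ φ x v ∂μ =
      -∫ x in Ω, g x * mollify (ρ n) μ (b n) x ∂μ := by
    filter_upwards [hρ.eventually_le_const hδ] with n hn
    exact hfg.integral_comp_mollify_mul_fderiv hf hh φ.contDiff φ.hasCompactSupport (ρ n)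
      ((Metric.cthickening_mono hn _).trans hδΩ)
  rw [setIntegral_mul_fderiv_eq_integral φ.tsupport_subset,
    tendsto_nhds_unique (hleft.congr' heq) hright.neg]
  congr 2 with x
  ring

end HasWeakDirDeriv

end ChainRule

section SobolevGraph

/-- Integration against `c` as a functional on `L^p`, for `c` in the conjugate Lebesgue space. -/
noncomputable def integralMulCLM {α : Type*} [MeasurableSpace α] {μ : Measure α} {p : ENNReal}
    [Fact (1 ≤ p)] {c : α → ℝ} (hc : MemLp c p.conjExponent μ) : Lp ℝ p μ →L[ℝ] ℝ :=
  have : Fact (1 ≤ p.conjExponent) := ⟨ENNReal.HolderConjugate.one_le _ p⟩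
  ((ContinuousLinearMap.mul ℝ ℝ).lpPairing μ p p.conjExponent).flip (hc.toLp c)

theorem integralMulCLM_apply {α : Type*} [MeasurableSpace α] {μ : Measure α} {p : ENNReal}
    [Fact (1 ≤ p)] {c : α → ℝ} (hc : MemLp c p.conjExponent μ) (u : Lp ℝ p μ) :
    integralMulCLM hc u = ∫ x, u x * c x ∂μ := by
  have : Fact (1 ≤ p.conjExponent) := ⟨ENNReal.HolderConjugate.one_le _ p⟩
  refine (ContinuousLinearMap.lpPairing_eq_integral _ _ _).trans (integral_congr_ae ?_)
  filter_upwards [hc.coeFn_toLp] with x hx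
  rw [hx, ContinuousLinearMap.mul_apply']

variable {N : ℕ} {p : ℝ} {Ω : Opens (RN N)}

theorem weakPartial_eq (hp : 1 ≤ p) {i : Fin N} {u g : LpOn p Ω} (h : HasWeakPartial i u g) :
    weakPartial i u = g := by
  have hex : ∃ g : LpOn p Ω, HasWeakPartial i u g := ⟨g, h⟩
  rw [weakPartial, dif_pos hex]
  exact hex.choose_spec.unique hp h

/-- Tuples `x = (u, g₁, …, g_N)` of `L^p` functions with the `ℓ^p` norm, where `u = x none` and
`g_i = x (some i)`. -/
abbrev LpTuple {N : ℕ} (p : ℝ) (Ω : Opens (RN N)) : Type :=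
  PiLp (ENNReal.ofReal p) fun _ : Option (Fin N) => LpOn p Ω

theorem memLp_restrict_testFunction (φ : TestFunction Ω ℝ ⊤) (q : ENNReal) :
    MemLp φ q (volume.restrict (Ω : Set (RN N))) :=
  φ.continuous.memLp_of_hasCompactSupport φ.hasCompactSupport

theorem memLp_restrict_fderiv_testFunction (φ : TestFunction Ω ℝ ⊤) (v : RN N) (q : ENNReal) :
    MemLp (fun x => fderiv ℝ φ x v) q (volume.restrict (Ω : Set (RN N))) :=
  ((φ.contDiff.continuous_fderiv (by simp)).clm_apply
    continuous_const).memLp_of_hasCompactSupport (φ.hasCompactSupport.fderiv_apply ℝ v)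

variable [Fact (1 ≤ ENNReal.ofReal p)]

/-- The functional `(u, g₁, …, g_N) ↦ ∫_Ω u ∂_i φ + ∫_Ω g_i φ`, which measures the failure of `g_i`
to be the weak derivative `∂_i u` when tested against `φ`. -/
noncomputable def weakPartialDefect (i : Fin N) (φ : TestFunction Ω ℝ ⊤) : LpTuple p Ω →L[ℝ] ℝ :=
  integralMulCLM (memLp_restrict_fderiv_testFunction φ (EuclideanSpace.single i 1) _) ∘L
      PiLp.proj _ _ none +
    integralMulCLM (memLp_restrict_testFunction φ _) ∘L PiLp.proj _ _ (some i)

theorem weakPartialDefect_eq_zero_iff {i : Fin N} {φ : TestFunction Ω ℝ ⊤} {x : LpTuple p Ω} :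
    weakPartialDefect i φ x = 0 ↔
      ∫ t in (Ω : Set (RN N)), x none t * fderiv ℝ φ t (EuclideanSpace.single i 1) =
        -∫ t in (Ω : Set (RN N)), x (some i) t * φ t := by
  simp only [weakPartialDefect, _root_.add_apply, ContinuousLinearMap.comp_apply, PiLp.proj_apply,
    integralMulCLM_apply, add_eq_zero_iff_eq_neg]

/-- The graph of the weak gradient: the tuples `(u, ∂₁u, …, ∂_Nu)` with `u ∈ W^{1,p}(Ω)`. It turns
`W^{1,p}(Ω)` into a closed subspace of `LpTuple p Ω`, with the same norm. -/
noncomputable def sobolevGraph (p : ℝ) [Fact (1 ≤ ENNReal.ofReal p)] (Ω : Opens (RN N)) :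
    Submodule ℝ (LpTuple p Ω) :=
  ⨅ (i : Fin N) (φ : TestFunction Ω ℝ ⊤), (weakPartialDefect (p := p) i φ).ker

theorem mem_sobolevGraph {x : LpTuple p Ω} :
    x ∈ sobolevGraph p Ω ↔ ∀ i, HasWeakPartial i (x none) (x (some i)) := by
  simp only [sobolevGraph, Submodule.mem_iInf, LinearMap.mem_ker, ContinuousLinearMap.coe_coe,
    weakPartialDefect_eq_zero_iff, HasWeakPartial]

theorem isClosed_sobolevGraph : IsClosed (sobolevGraph p Ω : Set (LpTuple p Ω)) := by
  simp only [sobolevGraph, Submodule.coe_iInf]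
  exact isClosed_iInter fun i => isClosed_iInter fun φ => (weakPartialDefect i φ).isClosed_ker

theorem norm_le_norm_of_forall_norm_le {x y : LpTuple p Ω} (h : ∀ j, ‖y j‖ ≤ ‖x j‖) :
    ‖y‖ ≤ ‖x‖ := by
  have hp : 0 < p := one_pos.trans_le (ENNReal.one_le_ofReal.mp Fact.out)
  rw [← Real.rpow_le_rpow_iff (norm_nonneg _) (norm_nonneg _) hp, norm_piLp_rpow_eq_sum hp,
    norm_piLp_rpow_eq_sum hp]
  exact Finset.sum_le_sum fun j _ => Real.rpow_le_rpow (norm_nonneg _) (h j) hp.le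

theorem sobolevNormPow_eq_norm_rpow {x : LpTuple p Ω} (hx : x ∈ sobolevGraph p Ω) :
    sobolevNormPow (x none) = ‖x‖ ^ p := by
  have hp : 1 ≤ p := ENNReal.one_le_ofReal.mp Fact.out
  rw [norm_piLp_rpow_eq_sum (one_pos.trans_le hp), Fintype.sum_option, sobolevNormPow]
  simp only [weakPartial_eq hp (mem_sobolevGraph.mp hx _)]

theorem sobolevNorm_eq_norm {x : LpTuple p Ω} (hx : x ∈ sobolevGraph p Ω) :
    sobolevNorm (x none) = ‖x‖ := by
  have hp : 0 < p := one_pos.trans_le (ENNReal.one_le_ofReal.mp Fact.out)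
  rw [sobolevNorm, sobolevNormPow_eq_norm_rpow hx, one_div,
    Real.rpow_rpow_inv (norm_nonneg _) hp.ne']

theorem mem_W1p_iff {u : LpOn p Ω} : u ∈ W1p p Ω ↔ ∃ x ∈ sobolevGraph p Ω, x none = u := by
  constructor
  · intro hu
    choose g hg using hu
    exact ⟨WithLp.toLp _ fun j => j.elim u g, mem_sobolevGraph.mpr hg, rfl⟩
  · rintro ⟨x, hx, rfl⟩ i
    exact ⟨x (some i), mem_sobolevGraph.mp hx i⟩

/-- The part of the graph lying over `W^{1,p}(Ω) ∩ C_c(closure Ω)`. -/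
noncomputable def sobolevGraphCc (p : ℝ) [Fact (1 ≤ ENNReal.ofReal p)] (Ω : Opens (RN N)) :
    Submodule ℝ (LpTuple p Ω) where
  carrier := {x | x ∈ sobolevGraph p Ω ∧ x none ∈ W1pCc p Ω}
  add_mem' := by
    rintro x y ⟨hx, -, f, hf⟩ ⟨hy, -, g, hg⟩
    have hxy := add_mem hx hy
    refine ⟨hxy, mem_W1p_iff.mpr ⟨_, hxy, rfl⟩, f + g, ?_⟩
    filter_upwards [hf, hg, Lp.coeFn_add (x none) (y none)] with t hft hgt hadd ht
    rw [PiLp.add_apply, hadd, Pi.add_apply, hft ht, hgt ht,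
      CompactlySupportedContinuousMap.add_apply]
  zero_mem' := by
    refine ⟨zero_mem _, mem_W1p_iff.mpr ⟨_, zero_mem _, rfl⟩, 0, ?_⟩
    filter_upwards [Lp.coeFn_zero ℝ (ENNReal.ofReal p) (volume.restrict (Ω : Set (RN N)))]
      with t hzero ht
    rw [PiLp.zero_apply, hzero, CompactlySupportedContinuousMap.coe_zero, Pi.zero_apply,
      Pi.zero_apply]
  smul_mem' := by
    rintro c x ⟨hx, -, f, hf⟩
    have hcx := Submodule.smul_mem _ c hx
    refine ⟨hcx, mem_W1p_iff.mpr ⟨_, hcx, rfl⟩, c • f, ?_⟩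
    filter_upwards [hf, Lp.coeFn_smul c (x none)] with t hft hsmul ht
    rw [PiLp.smul_apply, hsmul, Pi.smul_apply, hft ht, CompactlySupportedContinuousMap.smul_apply]

/-- The part of the graph lying over `W1pTilde p Ω`. -/
noncomputable def sobolevGraphTilde (p : ℝ) [Fact (1 ≤ ENNReal.ofReal p)] (Ω : Opens (RN N)) :
    Submodule ℝ (LpTuple p Ω) :=
  (sobolevGraphCc p Ω).topologicalClosure

theorem sobolevGraphTilde_le : sobolevGraphTilde p Ω ≤ sobolevGraph p Ω :=
  Submodule.topologicalClosure_minimal _ (fun _ hx => hx.1) isClosed_sobolevGraph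

theorem isClosed_sobolevGraphTilde : IsClosed (sobolevGraphTilde p Ω : Set (LpTuple p Ω)) :=
  Submodule.isClosed_topologicalClosure _

theorem mem_W1pTilde_iff {u : LpOn p Ω} :
    u ∈ W1pTilde p Ω ↔ ∃ x ∈ sobolevGraphTilde p Ω, x none = u := by
  constructor
  · rintro ⟨hu, happrox⟩
    obtain ⟨x, hx, rfl⟩ := mem_W1p_iff.mp hu
    refine ⟨x, Metric.mem_closure_iff.mpr fun ε hε => ?_, rfl⟩
    obtain ⟨v, hv, hlt⟩ := happrox ε hε
    obtain ⟨y, hy, rfl⟩ := mem_W1p_iff.mp hv.1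
    exact ⟨y, ⟨hy, hv⟩, by rwa [dist_eq_norm, ← sobolevNorm_eq_norm (sub_mem hx hy)]⟩
  · rintro ⟨x, hx, rfl⟩
    have hxG := sobolevGraphTilde_le hx
    refine ⟨mem_W1p_iff.mpr ⟨x, hxG, rfl⟩, fun ε hε => ?_⟩
    obtain ⟨y, ⟨hy, hyc⟩, hlt⟩ := Metric.mem_closure_iff.mp hx ε hε
    exact ⟨y none, hyc, by rwa [dist_eq_norm, ← sobolevNorm_eq_norm (sub_mem hxG hy)] at hlt⟩

end SobolevGraph

section DominatedConvergence

theorem tendsto_Lp_of_dominated {α ι E : Type*} [MeasurableSpace α] {μ : Measure α}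
    [NormedAddCommGroup E] {p : ℝ} [Fact (1 ≤ ENNReal.ofReal p)] {l : Filter ι}
    [l.IsCountablyGenerated] {f : ι → Lp E (ENNReal.ofReal p) μ}
    {g u : Lp E (ENNReal.ofReal p) μ} (hbound : ∀ i, ∀ᵐ x ∂μ, ‖f i x - g x‖ ≤ ‖u x‖)
    (hlim : ∀ᵐ x ∂μ, Tendsto (fun i => f i x) l (𝓝 (g x))) : Tendsto f l (𝓝 g) := by
  have hp : 0 < p := one_pos.trans_le (ENNReal.one_le_ofReal.mp Fact.out)
  have hpow : ∀ i, ‖f i - g‖ ^ p = ∫ x, ‖f i x - g x‖ ^ p ∂μ := fun i => by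
    rw [norm_Lp_rpow_eq_integral hp]
    refine integral_congr_ae ?_
    filter_upwards [Lp.coeFn_sub (f i) g] with x hx
    rw [hx, Pi.sub_apply]
  have hint : Tendsto (fun i => ‖f i - g‖ ^ p) l (𝓝 0) := by
    simp only [hpow]
    rw [← integral_zero α ℝ (μ := μ)]
    refine tendsto_integral_filter_of_dominated_convergence (fun x => ‖u x‖ ^ p)
      (.of_forall fun i => ?_) (.of_forall fun i => ?_) (integrable_norm_rpow_Lp hp u) ?_
    · exact ((Lp.aestronglyMeasurable (f i)).sub
        (Lp.aestronglyMeasurable g)).norm.aemeasurable.pow_const p |>.aestronglyMeasurable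
    · filter_upwards [hbound i] with x hx
      rw [Real.norm_of_nonneg (by positivity)]
      exact Real.rpow_le_rpow (norm_nonneg _) hx hp.le
    · filter_upwards [hlim] with x hx
      simpa only [Real.zero_rpow hp.ne'] using
        (tendsto_iff_norm_sub_tendsto_zero.mp hx).rpow_const (.inr hp.le)
  rw [tendsto_iff_norm_sub_tendsto_zero]
  have hroot := hint.rpow_const (p := p⁻¹) (.inr (inv_nonneg.mpr hp.le))
  rw [Real.zero_rpow (inv_ne_zero hp.ne')] at hroot
  exact hroot.congr fun i => Real.rpow_rpow_inv (norm_nonneg _) hp.ne'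

end DominatedConvergence

section SmoothAbs

open scoped ContDiff

variable {δ : ℝ}

/-- A smooth approximation of the absolute value from below, vanishing at `0`. -/
noncomputable def smoothAbs (δ t : ℝ) : ℝ := √(t ^ 2 + δ ^ 2) - δ

theorem smoothAbs_zero (hδ : 0 ≤ δ) : smoothAbs δ 0 = 0 := by
  rw [smoothAbs, zero_pow two_ne_zero, zero_add, Real.sqrt_sq hδ, sub_self]

theorem contDiff_smoothAbs (hδ : δ ≠ 0) : ContDiff ℝ ∞ (smoothAbs δ) :=
  (((contDiff_id.pow 2).add contDiff_const).sqrt fun t =>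
    (add_pos_of_nonneg_of_pos (sq_nonneg t) (sq_pos_of_ne_zero hδ)).ne').sub contDiff_const

theorem lipschitzWith_smoothAbs (δ : ℝ) : LipschitzWith 1 (smoothAbs δ) := by
  refine LipschitzWith.of_dist_le_mul fun s t => ?_
  have hnorm : ∀ r : ℝ, √(r ^ 2 + δ ^ 2) = ‖(⟨r, δ⟩ : ℂ)‖ := fun r => by
    rw [Complex.norm_eq_sqrt_sq_add_sq]
  calc dist (smoothAbs δ s) (smoothAbs δ t)
      = |‖(⟨s, δ⟩ : ℂ)‖ - ‖(⟨t, δ⟩ : ℂ)‖| := by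
        rw [Real.dist_eq, smoothAbs, smoothAbs, sub_sub_sub_cancel_right, hnorm, hnorm]
    _ ≤ ‖(⟨s, δ⟩ : ℂ) - ⟨t, δ⟩‖ := abs_norm_sub_norm_le _ _
    _ = ‖((s - t : ℝ) : ℂ)‖ := by
        congr 1
        apply Complex.ext <;> simp
    _ = (1 : NNReal) * dist s t := by
        rw [Complex.norm_real, NNReal.coe_one, one_mul, Real.dist_eq, Real.norm_eq_abs]

theorem smoothAbs_nonneg (δ t : ℝ) : 0 ≤ smoothAbs δ t :=
  sub_nonneg.mpr (Real.le_sqrt_of_sq_le (le_add_of_nonneg_left (sq_nonneg t)))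

theorem smoothAbs_le_abs (hδ : 0 ≤ δ) (t : ℝ) : smoothAbs δ t ≤ |t| := by
  rw [smoothAbs, sub_le_iff_le_add]
  refine Real.sqrt_le_iff.mpr ⟨by positivity, ?_⟩
  rw [add_sq, sq_abs, add_right_comm]
  exact le_add_of_nonneg_right (by positivity)

theorem tendsto_smoothAbs (t : ℝ) : Tendsto (fun δ => smoothAbs δ t) (𝓝 0) (𝓝 |t|) := by
  have hcont : Continuous fun δ => smoothAbs δ t := by unfold smoothAbs; fun_prop
  have h0 : smoothAbs 0 t = |t| := by
    rw [smoothAbs, zero_pow two_ne_zero, add_zero, Real.sqrt_sq_eq_abs, sub_zero]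
  simpa only [h0] using hcont.tendsto 0

end SmoothAbs

section NormalContraction

open scoped ContDiff

variable {N : ℕ} {p : ℝ} {Ω : Opens (RN N)}

theorem exists_continuous_ae_eq_of_mem_W1pCc {u : LpOn p Ω} (hu : u ∈ W1pCc p Ω) :
    ∃ f : RN N → ℝ, Continuous f ∧ u =ᵐ[volume.restrict (Ω : Set (RN N))] f := by
  obtain ⟨-, f, hf⟩ := hu
  obtain ⟨F, hF⟩ := f.toContinuousMap.exists_restrict_eq isClosed_closure
  refine ⟨F, F.continuous, ?_⟩
  filter_upwards [hf, ae_restrict_mem Ω.isOpen.measurableSet] with x hx hxΩ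
  rw [hx (subset_closure hxΩ)]
  exact (DFunLike.congr_fun hF ⟨x, subset_closure hxΩ⟩).symm

theorem exists_ae_eq_mul_norm_le {α : Type*} [MeasurableSpace α] {μ : Measure α} {q : ENNReal}
    {c : α → ℝ} (hc : AEStronglyMeasurable c μ) (hc1 : ∀ x, ‖c x‖ ≤ 1) (u : Lp ℝ q μ) :
    ∃ w : Lp ℝ q μ, w =ᵐ[μ] (fun x => c x * u x) ∧ ‖w‖ ≤ ‖u‖ := by
  have hle : ∀ x, ‖c x * u x‖ ≤ ‖u x‖ := fun x => by
    rw [norm_mul]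
    exact mul_le_of_le_one_left (norm_nonneg _) (hc1 x)
  have hmem : MemLp (fun x => c x * u x) q μ :=
    (Lp.memLp u).mono (hc.mul (Lp.aestronglyMeasurable u)) (.of_forall hle)
  refine ⟨hmem.toLp _, hmem.coeFn_toLp, Lp.norm_le_norm_of_ae_le ?_⟩
  filter_upwards [hmem.coeFn_toLp] with x hx
  rw [hx]
  exact hle x

theorem HasWeakPartial.comp (hp : 1 ≤ p) {i : Fin N} {u g w d : LpOn p Ω}
    (hug : HasWeakPartial i u g) {f : RN N → ℝ} (hf : Continuous f)
    (huf : u =ᵐ[volume.restrict (Ω : Set (RN N))] f) {h : ℝ → ℝ} (hh : ContDiff ℝ ∞ h)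
    (hw : w =ᵐ[volume.restrict (Ω : Set (RN N))] h ∘ u)
    (hd : d =ᵐ[volume.restrict (Ω : Set (RN N))] fun x => deriv h (f x) * g x) :
    HasWeakPartial i w d := by
  have hfg : HasWeakDirDeriv volume Ω (EuclideanSpace.single i 1) f g :=
    HasWeakDirDeriv.congr_ae hug huf .rfl
  have hg : LocallyIntegrableOn g Ω volume :=
    locallyIntegrableOn_of_locallyIntegrable_restrict
      ((Lp.memLp g).locallyIntegrable (ENNReal.one_le_ofReal.mpr hp))
  refine (hfg.comp hf hg hh).congr_ae ?_ hd.symm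
  filter_upwards [hw, huf] with x hwx hux
  rw [hwx, Function.comp_apply, hux]

theorem compLp_mem_W1pCc {u : LpOn p Ω} (hu : u ∈ W1pCc p Ω) {h : ℝ → ℝ}
    (hlip : LipschitzWith 1 h) (h0 : h 0 = 0) (hW : hlip.compLp h0 u ∈ W1p p Ω) :
    hlip.compLp h0 u ∈ W1pCc p Ω := by
  obtain ⟨-, f, hf⟩ := hu
  refine ⟨hW, f.compLeft ⟨h, hlip.continuous⟩, ?_⟩
  filter_upwards [hf, hlip.coeFn_compLp h0 u] with x hx hcomp hxΩ
  rw [hcomp, Function.comp_apply, hx hxΩ, CompactlySupportedContinuousMap.compLeft_apply h0]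
  rfl

variable [Fact (1 ≤ ENNReal.ofReal p)]

theorem exists_mem_sobolevGraphCc_compLp {x : LpTuple p Ω} (hx : x ∈ sobolevGraphCc p Ω)
    {h : ℝ → ℝ} (hh : ContDiff ℝ ∞ h) (hlip : LipschitzWith 1 h) (h0 : h 0 = 0) :
    ∃ y ∈ sobolevGraphCc p Ω, y none = hlip.compLp h0 (x none) ∧ ‖y‖ ≤ ‖x‖ := by
  obtain ⟨f, hf, hxf⟩ := exists_continuous_ae_eq_of_mem_W1pCc hx.2
  choose g hg hg_le using fun i : Fin N =>
    exists_ae_eq_mul_norm_le (c := fun t => deriv h (f t))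
      ((hh.continuous_deriv (by simp)).comp hf).aestronglyMeasurable
      (fun t => by simpa using norm_deriv_le_of_lipschitz hlip (x₀ := f t)) (x (some i))
  let y : LpTuple p Ω := WithLp.toLp _ fun j => j.elim (hlip.compLp h0 (x none)) g
  have hy : y ∈ sobolevGraph p Ω := mem_sobolevGraph.mpr fun i =>
    (mem_sobolevGraph.mp hx.1 i).comp (ENNReal.one_le_ofReal.mp Fact.out) hf hxf hh
      (hlip.coeFn_compLp h0 _) (hg i)
  refine ⟨y, ⟨hy, compLp_mem_W1pCc hx.2 hlip h0 (mem_W1p_iff.mpr ⟨y, hy, rfl⟩)⟩, rfl,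
    norm_le_norm_of_forall_norm_le fun j => ?_⟩
  cases j with
  | none => exact (hlip.norm_compLp_le h0 (x none)).trans_eq (by rw [NNReal.coe_one, one_mul])
  | some i => exact hg_le i

end NormalContraction

section Abs

variable {N : ℕ} {p : ℝ} [Fact (1 ≤ ENNReal.ofReal p)] {Ω : Opens (RN N)}

theorem uniformConvexSpace_LpTuple (hp : 1 < p) : UniformConvexSpace (LpTuple p Ω) :=
  (powUniformlyConvex_of_strictConvexSpace hp).lp.piLp.uniformConvexSpace hp.le

theorem exists_mem_sobolevGraphTilde_abs_of_mem_sobolevGraphCc (hp : 1 < p) {x : LpTuple p Ω}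
    (hx : x ∈ sobolevGraphCc p Ω) :
    ∃ y ∈ sobolevGraphTilde p Ω, y none = |x none| ∧ ‖y‖ ≤ ‖x‖ := by
  have hδ : ∀ n : ℕ, 0 < 1 / ((n : ℝ) + 1) := fun n => Nat.one_div_pos_of_nat
  choose y hyCc hy hy_le using fun n : ℕ => exists_mem_sobolevGraphCc_compLp hx
    (contDiff_smoothAbs (hδ n).ne') (lipschitzWith_smoothAbs _) (smoothAbs_zero (hδ n).le)
  have hy_ae : ∀ᵐ t ∂(volume.restrict (Ω : Set (RN N))), ∀ n : ℕ,
      y n none t = smoothAbs (1 / ((n : ℝ) + 1)) (x none t) := ae_all_iff.mpr fun n => by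
    rw [hy n]
    exact LipschitzWith.coeFn_compLp _ _ _
  have : UniformConvexSpace (LpTuple p Ω) := uniformConvexSpace_LpTuple hp
  refine exists_mem_map_eq_norm_le (PiLp.proj _ (fun _ => LpOn p Ω) none)
    isClosed_sobolevGraphTilde (sobolevGraphTilde p Ω).convex
    (fun n => Submodule.le_topologicalClosure _ (hyCc n)) hy_le tendsto_const_nhds
    (tendsto_Lp_of_dominated (u := x none) (fun n => ?_) ?_)
  · filter_upwards [hy_ae, Lp.coeFn_abs (x none)] with t hyt habs
    rw [PiLp.proj_apply, hyt n, habs, Real.norm_eq_abs, Real.norm_eq_abs,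
      abs_of_nonpos (sub_nonpos.mpr (smoothAbs_le_abs (hδ n).le _)), neg_sub]
    exact sub_le_self _ (smoothAbs_nonneg _ _)
  · filter_upwards [hy_ae, Lp.coeFn_abs (x none)] with t hyt habs
    simp only [PiLp.proj_apply, hyt, habs]
    exact (tendsto_smoothAbs _).comp tendsto_one_div_add_atTop_nhds_zero_nat

theorem exists_mem_sobolevGraphTilde_abs (hp : 1 < p) {x : LpTuple p Ω}
    (hx : x ∈ sobolevGraphTilde p Ω) :
    ∃ y ∈ sobolevGraphTilde p Ω, y none = |x none| ∧ ‖y‖ ≤ ‖x‖ := by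
  obtain ⟨s, hs, hsx⟩ := mem_closure_iff_seq_limit.mp hx
  choose y hyT hy hy_le using fun n =>
    exists_mem_sobolevGraphTilde_abs_of_mem_sobolevGraphCc hp (hs n)
  let π : LpTuple p Ω →L[ℝ] LpOn p Ω := PiLp.proj _ _ none
  have habs : Continuous fun u : LpOn p Ω => |u| := continuous_id.sup continuous_neg
  have : UniformConvexSpace (LpTuple p Ω) := uniformConvexSpace_LpTuple hp
  refine exists_mem_map_eq_norm_le π isClosed_sobolevGraphTilde (sobolevGraphTilde p Ω).convex hyT
    hy_le hsx.norm ?_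
  exact (((habs.comp π.continuous).tendsto x).comp hsx).congr fun n => (hy n).symm

end Abs

section Capacity

variable {N : ℕ} {p : ℝ} {Ω : Opens (RN N)}

theorem admissible_anti {A B : Set (closure (Ω : Set (RN N)))} (h : A ⊆ B) :
    admissible p Ω B ⊆ admissible p Ω A :=
  fun _ ⟨hu, O, hO, hBO, hge⟩ => ⟨hu, O, hO, h.trans hBO, hge⟩

theorem relCap_mono {A B : Set (closure (Ω : Set (RN N)))} (h : A ⊆ B) :
    relCap p Ω A ≤ relCap p Ω B :=
  sInf_le_sInf (Set.image_mono (admissible_anti h))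

theorem exists_isOpen_relCap_lt {A : Set (closure (Ω : Set (RN N)))} {c : EReal}
    (h : relCap p Ω A < c) : ∃ O, IsOpen O ∧ A ⊆ O ∧ relCap p Ω O < c := by
  obtain ⟨_, ⟨u, ⟨hu, O, hO, hAO, hge⟩, rfl⟩, hlt⟩ := sInf_lt_iff.mp h
  exact ⟨O, hO, hAO, lt_of_le_of_lt (sInf_le ⟨u, ⟨hu, O, hO, subset_rfl, hge⟩, rfl⟩) hlt⟩

theorem relCap_eq_sInf_isOpen (A : Set (closure (Ω : Set (RN N)))) :
    relCap p Ω A = sInf (relCap p Ω '' {O | IsOpen O ∧ A ⊆ O}) := by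
  refine le_antisymm (le_sInf ?_) (le_of_forall_gt fun c hc => ?_)
  · rintro _ ⟨O, ⟨-, hAO⟩, rfl⟩
    exact relCap_mono hAO
  · obtain ⟨O, hO, hAO, hlt⟩ := exists_isOpen_relCap_lt hc
    exact lt_of_le_of_lt (sInf_le ⟨O, ⟨hO, hAO⟩, rfl⟩) hlt

theorem tendsto_relCap_iInter {K : ℕ → Set (closure (Ω : Set (RN N)))} (hK : Antitone K)
    (hKc : ∀ n, IsCompact (K n)) :
    Tendsto (fun n => relCap p Ω (K n)) atTop (𝓝 (relCap p Ω (⋂ n, K n))) := by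
  refine tendsto_order.mpr ⟨fun c hc => .of_forall fun n =>
    hc.trans_le (relCap_mono (Set.iInter_subset K n)), fun c hc => ?_⟩
  obtain ⟨O, hO, hKO, hlt⟩ := exists_isOpen_relCap_lt hc
  obtain ⟨n, hn⟩ := exists_subset_nhds_of_isCompact hK.directed_ge hKc
    fun t ht => hO.mem_nhds (hKO ht)
  filter_upwards [eventually_ge_atTop n] with m hm
  exact (relCap_mono ((hK hm).trans hn)).trans_lt hlt

theorem coe_rpow_infEDist {E : Type*} [NormedAddCommGroup E] (hp : 0 < p) (S : Set E) :
    ((Metric.infEDist 0 S ^ p : ENNReal) : EReal) =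
      sInf ((fun x => ((‖x‖ ^ p : ℝ) : EReal)) '' S) := by
  have hmono : Monotone fun t : ENNReal => ((t ^ p : ENNReal) : EReal) :=
    EReal.coe_ennreal_strictMono.monotone.comp (ENNReal.monotone_rpow_of_nonneg hp.le)
  have hcont : Continuous fun t : ENNReal => ((t ^ p : ENNReal) : EReal) :=
    continuous_coe_ennreal_ereal.comp ENNReal.continuous_rpow_const
  have htop : ((⊤ ^ p : ENNReal) : EReal) = ⊤ := by
    rw [ENNReal.top_rpow_of_pos hp, EReal.coe_ennreal_top]
  have hnorm : ∀ x : E, ((edist 0 x ^ p : ENNReal) : EReal) = ((‖x‖ ^ p : ℝ) : EReal) := fun x => by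
    rw [edist_comm, edist_zero_right, ← ofReal_norm,
      ENNReal.ofReal_rpow_of_nonneg (norm_nonneg x) hp.le, EReal.coe_ennreal_ofReal,
      max_eq_left (by positivity)]
  rw [Metric.infEDist, ← sInf_image, hmono.map_sInf_of_continuousAt hcont.continuousAt htop,
    Set.image_image]
  simp only [hnorm]

variable [Fact (1 ≤ ENNReal.ofReal p)]

/-- The tuples in `sobolevGraphTilde p Ω` over the functions admissible for `A`. -/
def admissibleGraph (p : ℝ) [Fact (1 ≤ ENNReal.ofReal p)] (Ω : Opens (RN N))
    (A : Set (closure (Ω : Set (RN N)))) : Set (LpTuple p Ω) :=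
  {x | x ∈ sobolevGraphTilde p Ω ∧ x none ∈ admissible p Ω A}

theorem admissibleGraph_anti {A B : Set (closure (Ω : Set (RN N)))} (h : A ⊆ B) :
    admissibleGraph p Ω B ⊆ admissibleGraph p Ω A :=
  fun _ hx => ⟨hx.1, admissible_anti h hx.2⟩

theorem mem_admissibleGraph {A : Set (closure (Ω : Set (RN N)))} {x : LpTuple p Ω} :
    x ∈ admissibleGraph p Ω A ↔ x ∈ sobolevGraphTilde p Ω ∧
      ∃ O : Set (closure (Ω : Set (RN N))), IsOpen O ∧ A ⊆ O ∧
        ∀ᵐ t ∂(volume.restrict (Ω : Set (RN N))), t ∈ Subtype.val '' O → 1 ≤ x none t :=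
  and_congr_right fun hx => and_iff_right (mem_W1pTilde_iff.mpr ⟨x, hx, rfl⟩)

theorem image_admissibleGraph (A : Set (closure (Ω : Set (RN N)))) :
    (fun x => x none) '' admissibleGraph p Ω A = admissible p Ω A := by
  refine Set.Subset.antisymm (Set.image_subset_iff.mpr fun x hx => hx.2) fun u hu => ?_
  obtain ⟨x, hx, rfl⟩ := mem_W1pTilde_iff.mp hu.1
  exact ⟨x, ⟨hx, hu⟩, rfl⟩

theorem convex_admissibleGraph (A : Set (closure (Ω : Set (RN N)))) :
    Convex ℝ (admissibleGraph p Ω A) := by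
  intro x hx y hy a b ha hb hab
  obtain ⟨hxT, O, hO, hAO, hxO⟩ := mem_admissibleGraph.mp hx
  obtain ⟨hyT, U, hU, hAU, hyU⟩ := mem_admissibleGraph.mp hy
  refine mem_admissibleGraph.mpr ⟨(sobolevGraphTilde p Ω).convex hxT hyT ha hb hab, O ∩ U,
    hO.inter hU, Set.subset_inter hAO hAU, ?_⟩
  filter_upwards [hxO, hyU, Lp.coeFn_add (a • x none) (b • y none), Lp.coeFn_smul a (x none),
    Lp.coeFn_smul b (y none)] with t hxt hyt hadd hax hby
  rintro ⟨s, ⟨hsO, hsU⟩, rfl⟩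
  rw [PiLp.add_apply, PiLp.smul_apply, PiLp.smul_apply, hadd, Pi.add_apply, hax, hby]
  calc (1 : ℝ) = a * 1 + b * 1 := by rw [mul_one, mul_one, hab]
    _ ≤ a * x none s + b * y none s :=
      add_le_add (mul_le_mul_of_nonneg_left (hxt ⟨s, hsO, rfl⟩) ha)
        (mul_le_mul_of_nonneg_left (hyt ⟨s, hsU, rfl⟩) hb)

theorem relCap_eq_rpow_infEDist (A : Set (closure (Ω : Set (RN N)))) :
    relCap p Ω A = ((Metric.infEDist 0 (admissibleGraph p Ω A) ^ p : ENNReal) : EReal) := by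
  have hp : 0 < p := one_pos.trans_le (ENNReal.one_le_ofReal.mp Fact.out)
  rw [relCap, coe_rpow_infEDist hp, ← image_admissibleGraph, Set.image_image]
  exact congrArg sInf <| Set.image_congr fun x hx => by
    rw [sobolevNormPow_eq_norm_rpow (sobolevGraphTilde_le hx.1)]

theorem relCap_empty : relCap p Ω ∅ = 0 := by
  have hp : 0 < p := one_pos.trans_le (ENNReal.one_le_ofReal.mp Fact.out)
  have h0 : (0 : LpTuple p Ω) ∈ admissibleGraph p Ω ∅ := mem_admissibleGraph.mpr
    ⟨zero_mem _, ∅, isOpen_empty, subset_rfl, .of_forall fun t ht => by simp at ht⟩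
  rw [relCap_eq_rpow_infEDist, Metric.infEDist_zero_of_mem h0, ENNReal.zero_rpow_of_pos hp,
    EReal.coe_ennreal_zero]

theorem add_tsum_mem_admissibleGraph_iUnion {A : ℕ → Set (closure (Ω : Set (RN N)))}
    {w : LpTuple p Ω} {z e : ℕ → LpTuple p Ω} (hw : w ∈ sobolevGraphTilde p Ω)
    (hz : ∀ n, z n ∈ admissibleGraph p Ω (A n)) (he : ∀ n, e n ∈ sobolevGraphTilde p Ω)
    (habs : ∀ n, e n none = |(z n - w) none|) (hsum : Summable e) :
    w + ∑' n, e n ∈ admissibleGraph p Ω (⋃ n, A n) := by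
  have htsum : ∑' n, e n ∈ sobolevGraphTilde p Ω :=
    isClosed_sobolevGraphTilde.mem_of_tendsto hsum.hasSum
      (.of_forall fun s => sum_mem fun n _ => he n)
  let π : LpTuple p Ω →L[ℝ] LpOn p Ω := PiLp.proj _ _ none
  have hπ : HasSum (fun n => e n none) ((∑' n, e n) none) := π.hasSum hsum.hasSum
  have hle : ∀ n, z n none ≤ (w + ∑' n, e n) none := fun n => by
    calc z n none = w none + (z n - w) none := by rw [← PiLp.add_apply, add_sub_cancel]
      _ ≤ w none + e n none := by
        rw [habs n]
        exact add_le_add_right (le_abs_self _) _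
      _ ≤ w none + (∑' n, e n) none :=
        add_le_add_right (le_hasSum hπ n fun m _ => by
          rw [habs m]
          exact abs_nonneg _) _
  choose O hO hAO hge using fun n => (mem_admissibleGraph.mp (hz n)).2
  refine mem_admissibleGraph.mpr
    ⟨add_mem hw htsum, ⋃ n, O n, isOpen_iUnion hO, Set.iUnion_mono hAO, ?_⟩
  filter_upwards [ae_all_iff.mpr fun n => (Lp.coeFn_le _ _).mpr (hle n), ae_all_iff.mpr hge]
    with t hzle hzge
  rintro ⟨s, hs, rfl⟩
  obtain ⟨n, hn⟩ := Set.mem_iUnion.mp hs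
  exact (hzge n ⟨s, hn, rfl⟩).trans (hzle n)

theorem iInter_closure_admissibleGraph_subset (hp : 1 < p)
    (A : ℕ → Set (closure (Ω : Set (RN N)))) :
    ⋂ n, closure (admissibleGraph p Ω (A n)) ⊆ closure (admissibleGraph p Ω (⋃ n, A n)) := by
  intro w hw
  rw [Set.mem_iInter] at hw
  have hwT : w ∈ sobolevGraphTilde p Ω :=
    closure_minimal (fun x hx => hx.1) isClosed_sobolevGraphTilde (hw 0)
  refine Metric.mem_closure_iff.mpr fun ε hε => ?_
  choose z hz hwz using fun n : ℕ =>
    Metric.mem_closure_iff.mp (hw n) (ε / 2 / 2 / 2 ^ n) (by positivity)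
  choose e he habs he_le using fun n =>
    exists_mem_sobolevGraphTilde_abs hp (sub_mem (hz n).1 hwT)
  have he_geom : ∀ n, ‖e n‖ ≤ ε / 2 / 2 / 2 ^ n := fun n =>
    (he_le n).trans (by rw [← dist_eq_norm']; exact (hwz n).le)
  have hgeom : HasSum (fun n : ℕ => ε / 2 / 2 / 2 ^ n) (ε / 2) := hasSum_geometric_two' _
  refine ⟨w + ∑' n, e n, add_tsum_mem_admissibleGraph_iUnion hwT hz he habs
    (.of_norm_bounded hgeom.summable he_geom), ?_⟩
  rw [dist_self_add_right]
  exact (tsum_of_norm_bounded hgeom he_geom).trans_lt (half_lt_self hε)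

theorem infEDist_admissibleGraph_iUnion (hp : 1 < p) {A : ℕ → Set (closure (Ω : Set (RN N)))}
    (hA : Monotone A) : Metric.infEDist 0 (admissibleGraph p Ω (⋃ n, A n)) =
      ⨆ n, Metric.infEDist 0 (admissibleGraph p Ω (A n)) := by
  have : UniformConvexSpace (LpTuple p Ω) := uniformConvexSpace_LpTuple hp
  refine le_antisymm ?_
    (iSup_le fun n => Metric.infEDist_anti (admissibleGraph_anti (Set.subset_iUnion A n)))
  rw [← Metric.infEDist_closure, ← infEDist_zero_iInter_closure
    (fun m n hmn => admissibleGraph_anti (hA hmn)) fun n => convex_admissibleGraph (A n)]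
  exact Metric.infEDist_anti (iInter_closure_admissibleGraph_subset hp A)

theorem tendsto_relCap_iUnion (hp : 1 < p) {A : ℕ → Set (closure (Ω : Set (RN N)))}
    (hA : Monotone A) :
    Tendsto (fun n => relCap p Ω (A n)) atTop (𝓝 (relCap p Ω (⋃ n, A n))) := by
  have hcont : Continuous fun t : ENNReal => ((t ^ p : ENNReal) : EReal) :=
    continuous_coe_ennreal_ereal.comp ENNReal.continuous_rpow_const
  simp only [relCap_eq_rpow_infEDist, infEDist_admissibleGraph_iUnion hp hA]
  exact (hcont.tendsto _).comp <| tendsto_atTop_iSup fun m n hmn =>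
    Metric.infEDist_anti (admissibleGraph_anti (hA hmn))

end Capacity

end RelCap

theorem mainTheorem2 (N : ℕ) (p : ℝ) (hp : 1 < p) (Ω : TopologicalSpace.Opens (RelCap.RN N)) :
    RelCap.IsNormedChoquetCapacity (RelCap.relCap p Ω) ∧
      ∀ A : Set (closure (Ω : Set (RelCap.RN N))),
        RelCap.relCap p Ω A =
          sInf (RelCap.relCap p Ω ''
            {O : Set (closure (Ω : Set (RelCap.RN N))) | IsOpen O ∧ A ⊆ O}) := by
  have : Fact (1 ≤ ENNReal.ofReal p) := ⟨ENNReal.one_le_ofReal.mpr hp.le⟩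
  exact ⟨{
    mono := fun _ _ => RelCap.relCap_mono
    tendsto_iUnion := fun _ hA => RelCap.tendsto_relCap_iUnion hp (monotone_nat_of_le_succ hA)
    tendsto_iInter := fun _ hK => RelCap.tendsto_relCap_iInter (antitone_nat_of_succ_le hK)
    empty := RelCap.relCap_empty }, RelCap.relCap_eq_sInf_isOpen⟩
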